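/- Let $n\ge 1$, $N,L\ge 0$, $\tau=e^{2\pi i/n}$, let $G\in GL_N(\mathbb C)$ satisfy $G^n=1$, and put $\sigma(X)=G^{-1}XG$. Fix $\hbar\in\mathbb R$, $\lambda\in\mathbb C$, $\mu_k\in\mathbb C$ $(k\in\mathbb Z_n)$ and $\epsilon\in\{1,-1\}$. Consider $L$ particles on the $n$ half-lines $\tau^k\mathbb R^+$, with positions $q_i=\tau^{\kappa_i}t_i$ ($t_i>0$, $\kappa_i\in\mathbb Z_n$), and let $\mathcal W$ be the space of wave functions with values in $(\mathbb C^N)^{\otimes L}$ that are smooth where the $t_i$ are pairwise distinct. On $\mathcal W$ let $\mathcal P_s$ and $P_s$ ($s\in S_L$) permute the positions and the spins, write $\mathcal P_{ij},P_{ij}$ for the transposition $s=(ij)$, let $(\mathcal Q_i\psi)(\dots,q_i,\dots)=\psi(\dots,\tau q_i,\dots)$, let $M_i$ be the action of a matrix $M\in \mathrm{Mat}_N(\mathbb C)$ on the $i$-th spin, and let $$d_i=-i\hbar\frac{\partial}{\partial q_i}+\lambda\sum_{j\ne i}\sum_{k\in\mathbb Z_n}\frac{1}{q_i-\tau^kq_j}\,\mathcal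 Q_i^{-k}\mathcal P_{ij}\mathcal Q_i^{k}+\sum_{k\in\mathbb Z_n}\frac{\mu_k}{q_i}\mathcal Q_i^k$$ be the Dunkl operators. Let $$\Lambda_P=\frac1{L!}\sum_{s\in S_L}\epsilon^{|s|}\mathcal P_sP_s,\qquad \Lambda_Q=\prod_{i=1}^L\frac1n\sum_{j\in\mathbb Z_n}\mathcal Q_i^jG_i^{-j},$$ where $|s|\in\{0,1\}$ is the parity of $s$, and let $\mathcal H\subset\mathcal W$ be the space of physical states, i.e. of the $\psi$ with $P_{ij}\mathcal P_{ij}\psi=\epsilon\psi$ for $i\ne j$ (exchange statistics) and $G_i\psi=\mathcal Q_i\psi$ for all $i$ (quasi-parity). With an auxiliary space $\mathbb C^N$ labelled $a$, let $E_{ij}$ be the matrix units, $P_{a\ell}=\sum_{i,j}E_{ij}\otimes(E_{ji})_\ell$, and define the formal series in $u^{-1}$ $$T_a(u)=\sum_{\ell=1}^L\sum_{p\ge 0}\frac{P_{a\ell}\,d_\ell^{\,p}}{u^{p+1}},\qquad B_a(u)=\sum_{j\in\mathbb Z_n}\tau^jG_a^jT_a(\tau^ju)G_a^{-j},\qquad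 \widetilde B(u)=B(u)\Lambda_P\Lambda_Q=\sum_{p\ge0}\frac{\widetilde B^{(p)}}{u^{p+1}} .$$ Then: 1. $\Lambda_P\Lambda_Q$ is a projector of $\mathcal W$ onto $\mathcal H$, and all coefficients of the entries of $\widetilde B(u)$ map $\mathcal W$ into $\mathcal H$; in particular they preserve exchange statistics and quasi-parity. 2. The twisted half-loop relations hold, with $P_{ab}=\sum_{i,j}E_{ij}\otimes E_{ji}$ and $\frac1{u-\tau^kv}=\sum_{m\ge0}\tau^{km}v^mu^{-m-1}$: $$[\widetilde B_a(u),\widetilde B_b(v)]=\sum_{k\in\mathbb Z_n}\Big[\tau^k\widetilde B_a(u)+\widetilde B_b(v),\frac{G_a^{-k}P_{ab}G_a^k}{u-\tau^kv}\Big].$$ 3. The charges $\widetilde I^{(k)}$ defined by $\mathrm{tr}_a\,\widetilde B_a(u)=\sum_{k\ge0}\widetilde I^{(k)}u^{-k-1}$ commute pairwise, and $\widetilde I^{(k)}=0$ unless $k\equiv0 \bmod n$. 4. The model has $\mathfrak{gl}_N[z]^\sigma=\{A(z)\in\mathfrak{gl}_N[z]\mid\sigma A(z)=A(\tau z)\}$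 as a symmetry: there is a homomorphism of complex Lie algebras $\rho$ from $\mathfrak{gl}_N[z]^\sigma$ to the operators on $\mathcal W$ such that $\rho\big(\sum_{k\in\mathbb Z_n}\tau^{-pk}\sigma^k(E_{ji})z^p\big)=\widetilde B^{(p)}_{ij}$ for all $p,i,j$ (these elements lie in and span $\mathfrak{gl}_N[z]^\sigma$), all $\rho(x)$ map $\mathcal W$ into $\mathcal H$, and all $\rho(x)$ commute with all $\widetilde I^{(k)}$. -/

import Mathlib

open scoped ContDiff Kronecker

attribute [local instance] LieRing.ofAssociativeRing

noncomputable section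

namespace TwistedCalogero

/-! ### Roots of unity and the star graph -/

/-- `root k = τ ^ k = exp (2 π i k / n)` for `k` in `ℤ / n`. -/
def root {n : ℕ} [NeZero n] (k : ZMod n) : ℂ := ZMod.stdAddChar k

theorem root_eq_exp {n : ℕ} [NeZero n] (k : ZMod n) :
    root k = Complex.exp (2 * Real.pi * Complex.I * (k.val : ℂ) / (n : ℂ)) := by
  have h := ZMod.stdAddChar_coe (N := n) (k.val : ℤ)
  simpa [root] using h

theorem norm_root {n : ℕ} [NeZero n] (k : ZMod n) : ‖root k‖ = 1 := by
  rw [root, ZMod.stdAddChar_apply]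
  exact Circle.norm_coe _

theorem root_ne_zero {n : ℕ} [NeZero n] (k : ZMod n) : root k ≠ 0 := by
  intro h
  have := norm_root k
  simp [h] at this

/-- The regular set: `L` particles at pairwise distinct positive distances from the node.
Together with a choice `κ : Fin L → ZMod n` of branches, `t ∈ regular L` describes the positions
`q i = τ ^ κ i * t i` with `q i ≠ 0` and `q i ≠ τ ^ k * q j` for `i ≠ j`, `k ∈ ℤ / n`. -/
def regular (L : ℕ) : Set (Fin L → ℝ) := {t | (∀ i, 0 < t i) ∧ Function.Injective t}

theorem isOpen_regular (L : ℕ) : IsOpen (regular L) := by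
  have h : regular L = (⋂ i, {t : Fin L → ℝ | 0 < t i}) ∩
      ⋂ i, ⋂ j, ⋂ _ : i ≠ j, {t : Fin L → ℝ | t i ≠ t j} := by
    ext t
    simp only [regular, Set.mem_ofPred_eq, Set.mem_inter_iff, Set.mem_iInter, Function.Injective]
    refine and_congr_right fun _ => ⟨fun h i j hij hh => hij (h hh), fun h i j hh => ?_⟩
    by_contra hij
    exact h i j hij hh
  rw [h]
  refine IsOpen.inter (isOpen_iInter_of_finite fun i => ?_)
    (isOpen_iInter_of_finite fun i => isOpen_iInter_of_finite fun j =>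
      isOpen_iInter_of_finite fun _ => ?_)
  · exact isOpen_lt continuous_const (continuous_apply i)
  · exact isOpen_ne_fun (continuous_apply i) (continuous_apply j)

theorem comp_perm_mem_regular {L : ℕ} (s : Equiv.Perm (Fin L)) {t : Fin L → ℝ} :
    (fun i => t (s i)) ∈ regular L ↔ t ∈ regular L := by
  constructor
  · rintro ⟨h1, h2⟩
    refine ⟨fun i => by simpa using h1 (s.symm i), fun i j hij => ?_⟩
    have := @h2 (s.symm i) (s.symm j) (by simpa using hij)
    simpa using this
  · rintro ⟨h1, h2⟩
    exact ⟨fun i => h1 _, fun i j hij => s.injective (h2 hij)⟩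

/-- The position `q i = τ ^ κ i * t i` of the `i`-th particle, on the branch `τ ^ κ i * ℝ⁺`. -/
def pos {n L : ℕ} [NeZero n] (i : Fin L) (κ : Fin L → ZMod n) (t : Fin L → ℝ) : ℂ :=
  root (κ i) * (t i : ℂ)

/-! ### Wave functions and the operators acting on them -/

/-- Smooth wave functions of `L` particles with spin in `ℂ ^ N` on `n` half-lines:
`ψ κ v t` is the component along `e (v 1) ⊗ ⋯ ⊗ e (v L)` of the wave function at the positions
`q i = τ ^ κ i * t i`. Only `t ∈ regular L` matters, and `ψ` is extended by zero elsewhere. -/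
def WaveFn (n N L : ℕ) :
    Submodule ℂ ((Fin L → ZMod n) → (Fin L → Fin N) → (Fin L → ℝ) → ℂ) where
  carrier := {ψ | ∀ κ v, ContDiffOn ℝ ∞ (ψ κ v) (regular L) ∧ ∀ t, t ∉ regular L → ψ κ v t = 0}
  add_mem' := by
    intro a b ha hb κ v
    refine ⟨(ha κ v).1.add (hb κ v).1, fun t ht => ?_⟩
    simp [(ha κ v).2 t ht, (hb κ v).2 t ht]
  zero_mem' := fun κ v => ⟨contDiffOn_const, fun _ _ => rfl⟩
  smul_mem' := by
    intro c a ha κ v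
    refine ⟨(ha κ v).1.const_smul c, fun t ht => ?_⟩
    simp [(ha κ v).2 t ht]

/-- Operators on wave functions. -/
abbrev Op (n N L : ℕ) : Type := Module.End ℂ (WaveFn n N L)

variable {n N L : ℕ}

/-- Permutation of positions, `ψ(q | v) ↦ ψ(q ∘ s | v)`; for `s = (i j)` it exchanges the
positions of the particles `i` and `j`. -/
def posPerm (s : Equiv.Perm (Fin L)) : Op n N L where
  toFun ψ := ⟨fun κ v t => ψ.1 (fun i => κ (s i)) v (fun i => t (s i)), fun κ v => by
    refine ⟨?_, fun t ht => (ψ.2 _ v).2 _ fun h => ht ((comp_perm_mem_regular s).1 h)⟩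
    exact (ψ.2 _ v).1.comp (contDiff_pi.2 fun i => contDiff_apply ℝ ℝ (s i)).contDiffOn
      fun t ht => (comp_perm_mem_regular s).2 ht⟩
  map_add' _ _ := rfl
  map_smul' _ _ := rfl

/-- Permutation of spins; for `s = (i j)` it exchanges the spins of the particles `i`
and `j`. -/
def spinPerm (s : Equiv.Perm (Fin L)) : Op n N L where
  toFun ψ := ⟨fun κ v t => ψ.1 κ (fun i => v (s i)) t, fun κ _ => ψ.2 κ _⟩
  map_add' _ _ := rfl
  map_smul' _ _ := rfl

/-- The power `Q i ^ k` of the operator `Q i` moving the particle `i` between branches: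
`ψ(…, q i, …) ↦ ψ(…, τ ^ k * q i, …)`. -/
def branch (i : Fin L) (k : ZMod n) : Op n N L where
  toFun ψ := ⟨fun κ v t => ψ.1 (Function.update κ i (k + κ i)) v t, fun _ v => ψ.2 _ v⟩
  map_add' _ _ := rfl
  map_smul' _ _ := rfl

theorem branch_zero (i : Fin L) : (branch i 0 : Op n N L) = 1 := by
  ext ψ κ v t
  simp [branch]

theorem branch_add (i : Fin L) (k l : ZMod n) :
    (branch i (k + l) : Op n N L) = branch i k * branch i l := by
  ext ψ κ v t
  simp only [branch, LinearMap.coe_mk, AddHom.coe_mk, Module.End.mul_apply,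
    Function.update_self, Function.update_idem]
  rw [← add_assoc, add_comm l k]

/-- The moved particle sits at `τ ^ k * q i`. -/
theorem pos_update [NeZero n] (i : Fin L) (k : ZMod n) (κ : Fin L → ZMod n) (t : Fin L → ℝ) :
    pos i (Function.update κ i (k + κ i)) t = root k * pos i κ t := by
  simp [pos, root, AddChar.map_add_eq_mul, mul_assoc]

/-- The matrix `M` acting on the spin of the particle `i`. -/
def spin (i : Fin L) (M : Matrix (Fin N) (Fin N) ℂ) : Op n N L where
  toFun ψ := ⟨fun κ v t => ∑ w, M (v i) w * ψ.1 κ (Function.update v i w) t, fun κ v =>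
    ⟨ContDiffOn.sum fun w _ => contDiffOn_const.mul (ψ.2 κ _).1, fun t ht =>
      Finset.sum_eq_zero fun w _ => by rw [(ψ.2 κ _).2 t ht, mul_zero]⟩⟩
  map_add' a b := by
    ext κ v t
    simp [mul_add, Finset.sum_add_distrib]
  map_smul' c a := by
    ext κ v t
    simp [Finset.mul_sum, mul_left_comm]

/-- Multiplication by a function which is smooth on the regular set. -/
def mulBy (f : (Fin L → ZMod n) → (Fin L → ℝ) → ℂ)
    (hf : ∀ κ, ContDiffOn ℝ ∞ (f κ) (regular L)) : Op n N L where
  toFun ψ := ⟨fun κ v t => f κ t * ψ.1 κ v t, fun κ v =>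
    ⟨(hf κ).mul (ψ.2 κ v).1, fun t ht => by simp [(ψ.2 κ v).2 t ht]⟩⟩
  map_add' a b := by
    ext κ v t
    simp [mul_add]
  map_smul' c a := by
    ext κ v t
    simp [mul_left_comm]

open Classical in
/-- The momentum `p i = - i ħ ∂ / ∂ q i`. On the branch `q i = τ ^ κ i * t i` the derivative
`∂ / ∂ q i` is `τ ^ (- κ i) * ∂ / ∂ t i`. -/
def momentum [NeZero n] (ℏ : ℝ) (i : Fin L) : Op n N L where
  toFun ψ := ⟨fun κ v t => if t ∈ regular L then
      -Complex.I * (ℏ : ℂ) * root (-κ i) * fderiv ℝ (ψ.1 κ v) t (Pi.single i 1) else 0,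
    fun κ v => by
      refine ⟨?_, fun t ht => if_neg ht⟩
      have h1 : ContDiffOn ℝ ∞ (fun t => fderiv ℝ (ψ.1 κ v) t) (regular L) :=
        (ψ.2 κ v).1.fderiv_of_isOpen (isOpen_regular L) (by simp)
      have h2 : ContDiffOn ℝ ∞ (fun t => -Complex.I * (ℏ : ℂ) * root (-κ i) *
          fderiv ℝ (ψ.1 κ v) t (Pi.single i 1)) (regular L) :=
        contDiffOn_const.mul (h1.clm_apply contDiffOn_const)
      exact h2.congr fun t ht => if_pos ht⟩
  map_add' a b := by
    ext κ v t
    by_cases ht : t ∈ regular L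
    · have ha := ((a.2 κ v).1.contDiffAt ((isOpen_regular L).mem_nhds ht)).differentiableAt
        (by simp)
      have hb := ((b.2 κ v).1.contDiffAt ((isOpen_regular L).mem_nhds ht)).differentiableAt
        (by simp)
      have := fderiv_add ha hb
      simp [ht, this, mul_add]
    · simp [ht]
  map_smul' c a := by
    ext κ v t
    by_cases ht : t ∈ regular L
    · have ha := ((a.2 κ v).1.contDiffAt ((isOpen_regular L).mem_nhds ht)).differentiableAt
        (by simp)
      have := fderiv_const_smul ha c
      simp [ht, this, mul_left_comm]
    · simp [ht]

theorem contDiff_pos [NeZero n] (i : Fin L) (κ : Fin L → ZMod n) :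
    ContDiff ℝ ∞ (pos i κ) :=
  contDiff_const.mul (Complex.ofRealCLM.contDiff.comp (contDiff_apply ℝ ℝ i))

theorem norm_pos_eq [NeZero n] (i : Fin L) (κ : Fin L → ZMod n) {t : Fin L → ℝ}
    (ht : t ∈ regular L) : ‖pos i κ t‖ = t i := by
  rw [pos, norm_mul, norm_root, one_mul, Complex.norm_real, Real.norm_of_nonneg (ht.1 i).le]

theorem pos_ne_zero [NeZero n] (i : Fin L) (κ : Fin L → ZMod n) {t : Fin L → ℝ}
    (ht : t ∈ regular L) : pos i κ t ≠ 0 := by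
  rw [← norm_pos_iff, norm_pos_eq i κ ht]
  exact ht.1 i

theorem pos_sub_ne_zero [NeZero n] {i j : Fin L} (hij : i ≠ j) (k : ZMod n)
    (κ : Fin L → ZMod n) {t : Fin L → ℝ} (ht : t ∈ regular L) :
    pos i κ t - root k * pos j κ t ≠ 0 := by
  intro h
  have := congrArg norm (sub_eq_zero.1 h)
  rw [norm_mul, norm_root, one_mul, norm_pos_eq i κ ht, norm_pos_eq j κ ht] at this
  exact hij (ht.2 this)

/-- Multiplication by `1 / q i`. -/
def invPos [NeZero n] (i : Fin L) : Op n N L :=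
  mulBy (fun κ t => (pos i κ t)⁻¹) fun κ =>
    (contDiff_pos i κ).contDiffOn.inv fun _ ht => pos_ne_zero i κ ht

/-- Multiplication by `1 / (q i - τ ^ k * q j)`, for `i ≠ j`. -/
def invDiff [NeZero n] {i j : Fin L} (hij : i ≠ j) (k : ZMod n) : Op n N L :=
  mulBy (fun κ t => (pos i κ t - root k * pos j κ t)⁻¹) fun κ =>
    ContDiffOn.inv
      ((contDiff_pos i κ).sub (contDiff_const.mul (contDiff_pos j κ))).contDiffOn
      fun _ ht => pos_sub_ne_zero hij k κ ht

/-- The Dunkl operators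
`d i = p i + lam * ∑ j ≠ i, ∑ k, 1 / (q i - τ ^ k * q j) * Q i ^ (-k) * P (i j) * Q i ^ k
  + ∑ k, μ k / q i * Q i ^ k`. The operator `Q i ^ (-k) * P (i j) * Q i ^ k` is the reflection
`ψ(…, q i, …, q j, …) ↦ ψ(…, τ ^ k * q j, …, τ ^ (-k) * q i, …)`, whose mirror is
`q i = τ ^ k * q j`. -/
def dunkl [NeZero n] (ℏ : ℝ) (lam : ℂ) (μ : ZMod n → ℂ) (i : Fin L) : Op n N L :=
  momentum ℏ i
    + lam • (∑ j : {j : Fin L // i ≠ j}, ∑ k : ZMod n,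
        invDiff j.2 k * (branch i (-k) * posPerm (Equiv.swap i j.1) * branch i k) : Op n N L)
    + ∑ k : ZMod n, μ k • (invPos i * branch i k : Op n N L)

/-! ### Exchange statistics and quasi-parity -/

/-- The number of transpositions in a permutation, modulo two. -/
def parity (s : Equiv.Perm (Fin L)) : ℕ := if Equiv.Perm.sign s = 1 then 0 else 1

/-- The projector onto states of exchange statistics `ε`. -/
def statProj (ε : ℂ) : Op n N L :=
  (1 / (Nat.factorial L : ℂ)) • ∑ s : Equiv.Perm (Fin L),
    ε ^ parity s • (posPerm s * spinPerm s : Op n N L)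

/-- `gpow G k = G ^ k` for `k ∈ ℤ / n`, where `G ^ n = 1`. -/
def gpow (G : GL (Fin N) ℂ) (k : ZMod n) : Matrix (Fin N) (Fin N) ℂ :=
  ((G ^ k.val : GL (Fin N) ℂ) : Matrix (Fin N) (Fin N) ℂ)

/-- The quasi-parity projector `∏ i, (1 / n) * ∑ j, Q i ^ j * G i ^ (-j)`, the (commuting)
factors being multiplied in the order `i = 1, …, L`. -/
def parityProj [NeZero n] (G : GL (Fin N) ℂ) : Op n N L :=
  (List.ofFn fun i : Fin L =>
    (1 / (n : ℂ)) • ∑ j : ZMod n, (branch i j * spin i (gpow G (-j)) : Op n N L)).prod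

/-- The wave functions with exchange statistics `ε` and quasi-parity:
`P (i j) 𝓟 (i j) ψ = ε ψ` for `i ≠ j`, and `G i ψ = Q i ψ` for all `i`. -/
def physical (n L : ℕ) (ε : ℂ) (G : GL (Fin N) ℂ) : Submodule ℂ (WaveFn n N L) where
  carrier := {ψ | (∀ i j : Fin L, i ≠ j →
      (spinPerm (Equiv.swap i j) * posPerm (Equiv.swap i j) : Op n N L) ψ = ε • ψ) ∧
    ∀ i : Fin L, (spin i (G : Matrix (Fin N) (Fin N) ℂ) : Op n N L) ψ = branch i 1 ψ}
  add_mem' := by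
    intro a b ha hb
    refine ⟨fun i j hij => ?_, fun i => ?_⟩
    · rw [map_add, ha.1 i j hij, hb.1 i j hij, smul_add]
    · rw [map_add, map_add, ha.2 i, hb.2 i]
  zero_mem' := ⟨fun i j _ => by rw [map_zero, smul_zero], fun i => by rw [map_zero, map_zero]⟩
  smul_mem' := by
    intro c a ha
    refine ⟨fun i j hij => ?_, fun i => ?_⟩
    · rw [LinearMap.map_smul, ha.1 i j hij]
      exact smul_comm c ε a
    · rw [LinearMap.map_smul, LinearMap.map_smul, ha.2 i]

/-! ### The monodromy matrices

A formal series `∑ m, f m / u ^ m` is the power series with coefficients `f m`; its indeterminate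
stands for `u ^ (-1)`. -/

open PowerSeries in
/-- `T(u) = ∑ ℓ, P_{a ℓ} / (u - d ℓ)`, where `P_{a ℓ} = ∑ i j, E_{ij} ⊗ (E_{ji})_ℓ` and
`1 / (u - d ℓ) = ∑ p, d ℓ ^ p / u ^ (p + 1)`. -/
def monodromy [NeZero n] (ℏ : ℝ) (lam : ℂ) (μ : ZMod n → ℂ) :
    Matrix (Fin N) (Fin N) (Op n N L)⟦X⟧ :=
  Matrix.of fun i j => ∑ ℓ : Fin L,
    PowerSeries.C (spin ℓ (Matrix.single j i 1)) *
      (PowerSeries.X * PowerSeries.mk fun p => dunkl ℏ lam μ ℓ ^ p)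

open PowerSeries in
/-- The series `f(c * u)`, for `f(u) = ∑ m, f m / u ^ m` and `c ≠ 0`. -/
def dilate {A : Type*} [Ring A] [Algebra ℂ A] (c : ℂ) (f : A⟦X⟧) : A⟦X⟧ :=
  PowerSeries.mk fun m => (c⁻¹) ^ m • PowerSeries.coeff m f

open PowerSeries in
/-- A complex matrix as a constant matrix over a ring of series. -/
def constMat {ι : Type*} (A : Type*) [Ring A] [Algebra ℂ A] (M : Matrix ι ι ℂ) :
    Matrix ι ι A⟦X⟧ :=
  M.map fun c => PowerSeries.C (algebraMap ℂ A c)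

open PowerSeries in
/-- `B(u) = ∑ j, τ ^ j G ^ j T(τ ^ j u) G ^ (-j)`. -/
def twisted [NeZero n] (G : GL (Fin N) ℂ) (ℏ : ℝ) (lam : ℂ) (μ : ZMod n → ℂ) :
    Matrix (Fin N) (Fin N) (Op n N L)⟦X⟧ :=
  ∑ j : ZMod n, root j • (constMat (Op n N L) (gpow G j) *
    (monodromy ℏ lam μ : Matrix (Fin N) (Fin N) (Op n N L)⟦X⟧).map (dilate (root j)) * constMat (Op n N L) (gpow G (-j)))

open PowerSeries in
/-- `B̃(u) = B(u) Λ_P Λ_Q`. -/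
def modified [NeZero n] (G : GL (Fin N) ℂ) (ε : ℂ) (ℏ : ℝ) (lam : ℂ) (μ : ZMod n → ℂ) :
    Matrix (Fin N) (Fin N) (Op n N L)⟦X⟧ :=
  (twisted G ℏ lam μ).map fun f => f * PowerSeries.C (statProj ε * parityProj G : Op n N L)

/-- The charges `Ĩ^(k)`: the coefficients of `u ^ (-(k + 1))` in `tr B̃(u)`. -/
def charge [NeZero n] (G : GL (Fin N) ℂ) (ε : ℂ) (ℏ : ℝ) (lam : ℂ) (μ : ZMod n → ℂ) (k : ℕ) :
    Op n N L :=
  PowerSeries.coeff (k + 1)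
    (modified G ε ℏ lam μ : Matrix (Fin N) (Fin N) (PowerSeries (Op n N L))).trace

/-! ### The twisted half-loop relations -/

open PowerSeries in
/-- The ring `A((v⁻¹))[[u⁻¹]]`: power series in `u⁻¹` whose coefficients are Laurent series
in `v⁻¹`. -/
abbrev TwoSeries (A : Type*) [Ring A] : Type _ := (LaurentSeries A)⟦X⟧

open PowerSeries in
/-- The series `f(u)` in `A((v⁻¹))[[u⁻¹]]`. -/
def inU {A : Type*} [Ring A] : A⟦X⟧ →+* TwoSeries A := PowerSeries.map HahnSeries.C

open PowerSeries in
/-- The series `f(v)` in `A((v⁻¹))[[u⁻¹]]`. -/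
def inV {A : Type*} [Ring A] : A⟦X⟧ →+* TwoSeries A :=
  (PowerSeries.C (R := LaurentSeries A)).comp (HahnSeries.ofPowerSeries ℤ A)

/-- A complex number in `A((v⁻¹))[[u⁻¹]]`. -/
def scalar {A : Type*} [Ring A] [Algebra ℂ A] (c : ℂ) : TwoSeries A :=
  PowerSeries.C (HahnSeries.C (algebraMap ℂ A c))

/-- `1 / (u - c * v) = ∑ m, c ^ m * v ^ m / u ^ (m + 1)`. -/
def kernel {A : Type*} [Ring A] [Algebra ℂ A] (c : ℂ) : TwoSeries A :=
  PowerSeries.X * PowerSeries.mk fun m => HahnSeries.single (-(m : ℤ)) (algebraMap ℂ A (c ^ m))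

/-- The defining property `(u - c * v) * (1 / (u - c * v)) = 1`, multiplied by `u⁻¹`. -/
theorem kernel_spec {A : Type*} [Ring A] [Algebra ℂ A] (c : ℂ) :
    (1 - PowerSeries.C (HahnSeries.single (-1) (algebraMap ℂ A c)) * PowerSeries.X) * kernel c
      = (PowerSeries.X : TwoSeries A) := by
  have h : (1 - PowerSeries.C (HahnSeries.single (-1) (algebraMap ℂ A c)) * PowerSeries.X) *
      (PowerSeries.mk fun m : ℕ =>
        (HahnSeries.single (-(m : ℤ)) (algebraMap ℂ A (c ^ m)) : LaurentSeries A)) = 1 := by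
    ext1 m
    rw [sub_mul, one_mul, mul_assoc, map_sub, PowerSeries.coeff_C_mul]
    cases m with
    | zero => simp
    | succ m =>
      rw [PowerSeries.coeff_succ_X_mul, PowerSeries.coeff_mk, PowerSeries.coeff_mk,
        HahnSeries.single_mul_single, ← map_mul, ← pow_succ', PowerSeries.coeff_one]
      simp
  rw [kernel, ← mul_assoc, (PowerSeries.commute_X _).eq, mul_assoc, h, mul_one]

/-- Matrices acting in two auxiliary spaces `a` and `b`. -/
abbrev AuxMat (N : ℕ) (R : Type*) : Type _ := Matrix (Fin N × Fin N) (Fin N × Fin N) R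

/-- `X_a`: the matrix `X` in the auxiliary space `a`. -/
def inA {R : Type*} [Ring R] (Y : Matrix (Fin N) (Fin N) R) : AuxMat N R := Y ⊗ₖ 1

/-- `X_b`: the matrix `X` in the auxiliary space `b`. -/
def inB {R : Type*} [Ring R] (Y : Matrix (Fin N) (Fin N) R) : AuxMat N R := 1 ⊗ₖ Y

/-- The permutation operator `P_{ab} = ∑ i j, E_{ij} ⊗ E_{ji}`. -/
def permAB (N : ℕ) : AuxMat N ℂ :=
  ∑ i : Fin N, ∑ j : Fin N, Matrix.single i j 1 ⊗ₖ Matrix.single j i 1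

open PowerSeries in
/-- The relations
`[B_a(u), B_b(v)] = ∑ k, [τ ^ k B_a(u) + B_b(v), G_a ^ (-k) P_{ab} G_a ^ k / (u - τ ^ k v)]`. -/
def TwistedHalfLoop (n : ℕ) [NeZero n] {A : Type*} [Ring A] [Algebra ℂ A] (G : GL (Fin N) ℂ)
    (B : Matrix (Fin N) (Fin N) A⟦X⟧) : Prop :=
  ⁅inA (B.map inU), inB (B.map inV)⁆ = ∑ k : ZMod n,
    ⁅(scalar (root k) : TwoSeries A) • inA (B.map inU) + inB (B.map inV),
      (kernel (root k) : TwoSeries A) •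
        (inA (gpow G (-k)) * permAB N * inA (gpow G k)).map scalar⁆

/-! ### The twisted loop algebra -/

/-- `σ(Y) = G⁻¹ Y G`, extended to matrices of polynomials in `z`. -/
def sigma (G : GL (Fin N) ℂ) (Y : Matrix (Fin N) (Fin N) (Polynomial ℂ)) :
    Matrix (Fin N) (Fin N) (Polynomial ℂ) :=
  ((G⁻¹ : GL (Fin N) ℂ) : Matrix (Fin N) (Fin N) ℂ).map Polynomial.C * Y *
    (G : Matrix (Fin N) (Fin N) ℂ).map Polynomial.C

/-- `Y(z) ↦ Y(τ z)`. -/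
def rotate (n : ℕ) [NeZero n] (Y : Matrix (Fin N) (Fin N) (Polynomial ℂ)) :
    Matrix (Fin N) (Fin N) (Polynomial ℂ) :=
  Y.map fun p => p.comp (Polynomial.C (root (1 : ZMod n)) * Polynomial.X)

theorem sigma_add (G : GL (Fin N) ℂ) (Y Z : Matrix (Fin N) (Fin N) (Polynomial ℂ)) :
    sigma G (Y + Z) = sigma G Y + sigma G Z := by
  simp [sigma, mul_add, add_mul]

theorem sigma_smul (G : GL (Fin N) ℂ) (c : ℂ) (Y : Matrix (Fin N) (Fin N) (Polynomial ℂ)) :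
    sigma G (c • Y) = c • sigma G Y := by
  simp [sigma]

theorem sigma_mul (G : GL (Fin N) ℂ) (Y Z : Matrix (Fin N) (Fin N) (Polynomial ℂ)) :
    sigma G (Y * Z) = sigma G Y * sigma G Z := by
  have h : (G : Matrix (Fin N) (Fin N) ℂ).map Polynomial.C *
      ((G⁻¹ : GL (Fin N) ℂ) : Matrix (Fin N) (Fin N) ℂ).map Polynomial.C = 1 := by
    rw [← Matrix.map_mul, ← Units.val_mul, mul_inv_cancel, Units.val_one]
    exact Matrix.map_one _ (by simp) (by simp)
  have h' : ∀ Z : Matrix (Fin N) (Fin N) (Polynomial ℂ),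
      (G : Matrix (Fin N) (Fin N) ℂ).map Polynomial.C *
      (((G⁻¹ : GL (Fin N) ℂ) : Matrix (Fin N) (Fin N) ℂ).map Polynomial.C * Z) = Z := fun Z => by
    rw [← mul_assoc, h, one_mul]
  simp only [sigma, mul_assoc, h']

theorem rotate_add (n : ℕ) [NeZero n] (Y Z : Matrix (Fin N) (Fin N) (Polynomial ℂ)) :
    rotate n (Y + Z) = rotate n Y + rotate n Z := by
  ext1 i j
  simp [rotate]

theorem rotate_smul (n : ℕ) [NeZero n] (c : ℂ) (Y : Matrix (Fin N) (Fin N) (Polynomial ℂ)) :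
    rotate n (c • Y) = c • rotate n Y := by
  ext1 i j
  simp [rotate]

theorem rotate_mul (n : ℕ) [NeZero n] (Y Z : Matrix (Fin N) (Fin N) (Polynomial ℂ)) :
    rotate n (Y * Z) = rotate n Y * rotate n Z := by
  exact Matrix.map_mul (f := Polynomial.compRingHom _)

/-- The Lie algebra `gl_N[z]^σ = {Y ∈ gl_N[z] | σ Y(z) = Y(τ z)}`. -/
def twistedLoop (n : ℕ) [NeZero n] (G : GL (Fin N) ℂ) :
    LieSubalgebra ℂ (Matrix (Fin N) (Fin N) (Polynomial ℂ)) where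
  carrier := {Y | sigma G Y = rotate n Y}
  add_mem' := by
    intro Y Z hY hZ
    rw [Set.mem_ofPred_eq] at *
    rw [sigma_add, rotate_add, hY, hZ]
  zero_mem' := by
    ext1 i j
    simp [sigma, rotate]
  smul_mem' := by
    intro c Y hY
    rw [Set.mem_ofPred_eq] at *
    rw [sigma_smul, rotate_smul, hY]
  lie_mem' := by
    intro Y Z hY hZ
    change sigma G (Y * Z - Z * Y) = rotate n (Y * Z - Z * Y)
    have hY' : sigma G Y = rotate n Y := hY
    have hZ' : sigma G Z = rotate n Z := hZ
    rw [sub_eq_add_neg, ← neg_one_smul ℂ (Z * Y), sigma_add, rotate_add, sigma_smul, rotate_smul,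
      sigma_mul, sigma_mul, rotate_mul, rotate_mul, hY', hZ']

/-- The element `∑ k, τ ^ (-p k) σ ^ k (E_{ji}) z ^ p` of `gl_N[z]`, that is `n` times the
projection of `E_{ji} z ^ p` to `gl_N[z]^σ`. -/
def generator (n : ℕ) [NeZero n] (G : GL (Fin N) ℂ) (p : ℕ) (i j : Fin N) :
    Matrix (Fin N) (Fin N) (Polynomial ℂ) :=
  ∑ k : ZMod n, root (-((p : ZMod n) * k)) •
    (sigma G)^[k.val] (Matrix.single j i ((Polynomial.X : Polynomial ℂ) ^ p))

end TwistedCalogero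

end

open TwistedCalogero

noncomputable section

namespace TwistedCalogero

section

variable {n N L : ℕ}

/-! Everything follows from one representation of the untwisted algebra `gl_N[z]`. The Dunkl
operators commute with each other (`dunkl_commute`) and with all spin matrices. Hence for each
particle ℓ the substitution `Y(z) ↦ Y(d_ℓ)`, with matrix coefficients acting on the ℓ-th spin, is a
homomorphism of algebras (`particleEval`). Images for different particles commute, so the sum over ℓ
is a homomorphism of Lie algebras (`loopRep_lie`).

The Dunkl operators are also equivariant under the wreath product of `S_L` and `ℤ_n` acting on
positions (`dunkl_mul_act`): permutations relabel them, and `d_i Q_i^k = τ^k Q_i^k d_i`. Therefore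
the sum over particles commutes with every particle permutation. If `Y` lies in `gl_N[z]^σ`, the
phase `τ^(kp)` from conjugating its coefficient of `z^p` by `G^k` cancels the phase of `d_i^p`, and
the sum commutes with the quasi-parities `Q_i^k G_i^(-k)` too. It then commutes with the idempotent
`Λ_P Λ_Q`; multiplying by this idempotent keeps the bracket and puts the image into the physical
space. This is `ρ`.

The coefficient of `u^(-p-1)` in an entry of `B̃` is the image under `ρ` of a σ-average of a matrix
unit times `z^p` (`coeff_modified_succ`). The half-loop relations are the brackets of such averages
(`twistAverage_lie`) packed into series. The charges are images of multiples of `z^k · 1`, which is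
central, and the multiple is a character sum that vanishes unless `n ∣ k`.

The analytic core is the commutativity of the Dunkl operators. Their commutator is sorted into
momentum, exchange and impurity parts, and each piece reduces to an identity of rational functions
combined with a shift of a summation index in `ℤ_n`. -/

/-- A shortcut for instance search. -/
abbrev opRing (n N L : ℕ) : Ring (Op n N L) := Module.End.instRing

attribute [local instance] opRing

/-! ### Powers of `τ` as a character of `ℤ_n`. -/

theorem root_zero [NeZero n] : root (0 : ZMod n) = 1 := by simp [root]

theorem root_add [NeZero n] (k l : ZMod n) : root (k + l) = root k * root l := by
  simp [root, AddChar.map_add_eq_mul]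

theorem root_neg [NeZero n] (k : ZMod n) : root (-k) = (root k)⁻¹ := by
  simp [root, AddChar.map_neg_eq_inv]

theorem root_sub [NeZero n] (k l : ZMod n) : root (k - l) = root k / root l := by
  rw [sub_eq_add_neg, root_add, root_neg, div_eq_mul_inv]

/-! ### The action of the wreath product on positions -/

/-- The operator `ψ(κ, v, t) ↦ ψ(κ ∘ s + a, v, t ∘ s)`. -/
def act (s : Equiv.Perm (Fin L)) (a : Fin L → ZMod n) : Op n N L where
  toFun ψ := ⟨fun κ v t => ψ.1 (fun i => κ (s i) + a i) v (fun i => t (s i)), fun κ v => by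
    refine ⟨?_, fun t ht => (ψ.2 _ v).2 _ fun h => ht ((comp_perm_mem_regular s).1 h)⟩
    exact (ψ.2 _ v).1.comp (contDiff_pi.2 fun i => contDiff_apply ℝ ℝ (s i)).contDiffOn
      fun t ht => (comp_perm_mem_regular s).2 ht⟩
  map_add' _ _ := rfl
  map_smul' _ _ := rfl

theorem act_apply (s : Equiv.Perm (Fin L)) (a : Fin L → ZMod n) (ψ : WaveFn n N L)
    (κ v t) : ((act s a : Op n N L) ψ).1 κ v t =
      ψ.1 (fun i => κ (s i) + a i) v (fun i => t (s i)) := rfl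

theorem mulBy_apply (f : (Fin L → ZMod n) → (Fin L → ℝ) → ℂ) (hf) (ψ : WaveFn n N L)
    (κ v t) : ((mulBy f hf : Op n N L) ψ).1 κ v t = f κ t * ψ.1 κ v t := rfl

theorem act_mul (s s' : Equiv.Perm (Fin L)) (a a' : Fin L → ZMod n) :
    (act s a * act s' a' : Op n N L) = act (s * s') (fun i => a (s' i) + a' i) := by
  ext ψ κ v t
  simp only [Module.End.mul_apply, act_apply, Equiv.Perm.mul_apply, add_assoc]

theorem posPerm_eq_act (s : Equiv.Perm (Fin L)) : (posPerm s : Op n N L) = act s 0 := by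
  ext ψ κ v t
  simp [posPerm, act_apply]

theorem branch_eq_act (i : Fin L) (k : ZMod n) :
    (branch i k : Op n N L) = act 1 (Pi.single i k) := by
  ext ψ κ v t
  simp only [branch, LinearMap.coe_mk, AddHom.coe_mk, act_apply, Equiv.Perm.one_apply]
  refine congrArg (fun κ' => ψ.1 κ' v t) (funext fun m => ?_)
  by_cases h : m = i
  · subst h; simp [add_comm]
  · simp [h]

/-- Wave functions are extended by zero, so both sides agree automatically off the regular set. -/
theorem op_ext {S T : Op n N L}
    (h : ∀ ψ κ v, ∀ t ∈ regular L, (S ψ).1 κ v t = (T ψ).1 κ v t) : S = T := by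
  refine LinearMap.ext fun ψ => Subtype.ext (funext fun κ => funext fun v => funext fun t => ?_)
  by_cases ht : t ∈ regular L
  · exact h ψ κ v t ht
  · rw [((S ψ).2 κ v).2 t ht, ((T ψ).2 κ v).2 t ht]

/-- `act s a` substitutes `τ^(a i) q_(s i)` for `q_i`. All covariance properties of functions of the
positions come from this. -/
theorem pos_act [NeZero n] (s : Equiv.Perm (Fin L)) (a : Fin L → ZMod n) (i : Fin L) (κ t) :
    pos i (fun i => κ (s i) + a i) (fun i => t (s i)) = root (a i) * pos (s i) κ t := by
  simp only [pos, root_add]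
  ring

open Classical in
/-- Multiplication by `1 / (q i - τ ^ k * q j)` if `i ≠ j`, and zero if `i = j`. -/
def weight [NeZero n] (i j : Fin L) (k : ZMod n) : Op n N L :=
  if h : i ≠ j then invDiff h k else 0

theorem weight_apply [NeZero n] {i j : Fin L} (h : i ≠ j) (k : ZMod n) (ψ : WaveFn n N L)
    (κ v t) : ((weight i j k : Op n N L) ψ).1 κ v t =
      (pos i κ t - root k * pos j κ t)⁻¹ * ψ.1 κ v t := by
  rw [weight, dif_pos h]
  rfl

theorem weight_self [NeZero n] (i : Fin L) (k : ZMod n) : (weight i i k : Op n N L) = 0 := by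
  simp [weight]

theorem invPos_apply [NeZero n] (i : Fin L) (ψ : WaveFn n N L)
    (κ v t) : ((invPos i : Op n N L) ψ).1 κ v t = (pos i κ t)⁻¹ * ψ.1 κ v t := rfl

/-- The substitution in `1 / (q_i - τ^k q_j)` lets one factor out `τ^(a i)`; what is left is the
same function with `k` shifted by `a j - a i`. -/
theorem act_mul_weight [NeZero n] (s : Equiv.Perm (Fin L)) (a : Fin L → ZMod n) (i j : Fin L)
    (k : ZMod n) : (act s a * weight i j k : Op n N L) =
      (root (a i))⁻¹ • (weight (s i) (s j) (k + a j - a i) * act s a : Op n N L) := by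
  by_cases h : i = j
  · subst h
    simp [weight_self]
  · refine op_ext fun ψ κ v t ht => ?_
    have h' : s i ≠ s j := s.injective.ne h
    simp only [Module.End.mul_apply, act_apply, weight_apply h, LinearMap.smul_apply,
      Submodule.coe_smul, Pi.smul_apply, weight_apply h', smul_eq_mul, pos_act]
    rw [← mul_assoc (root (a i))⁻¹, ← mul_inv]
    congr 2
    have := root_ne_zero (a i)
    rw [root_sub, root_add]
    field_simp

theorem act_mul_invPos [NeZero n] (s : Equiv.Perm (Fin L)) (a : Fin L → ZMod n) (i : Fin L) :
    (act s a * invPos i : Op n N L) = (root (a i))⁻¹ • (invPos (s i) * act s a : Op n N L) := by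
  refine op_ext fun ψ κ v t ht => ?_
  simp only [Module.End.mul_apply, act_apply, invPos_apply, LinearMap.smul_apply,
      Submodule.coe_smul, Pi.smul_apply, smul_eq_mul, pos_act]
  rw [← mul_assoc, ← mul_inv]

theorem momentum_apply [NeZero n] (ℏ : ℝ) (i : Fin L) (ψ : WaveFn n N L) (κ v) {t}
    (ht : t ∈ regular L) : ((momentum ℏ i : Op n N L) ψ).1 κ v t =
      -Complex.I * (ℏ : ℂ) * root (-κ i) * fderiv ℝ (ψ.1 κ v) t (Pi.single i 1) := by
  exact if_pos ht

theorem differentiableAt_wave (ψ : WaveFn n N L) (κ v) {t} (ht : t ∈ regular L) :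
    DifferentiableAt ℝ (ψ.1 κ v) t :=
  ((ψ.2 κ v).1.contDiffAt ((isOpen_regular L).mem_nhds ht)).differentiableAt (by simp)

/-- Chain rule for a permutation of the coordinates. The phase `τ^(a i)` appears because the
momentum carries the inverse branch factor, and the branch is moved by `a i`. -/
theorem momentum_mul_act [NeZero n] (ℏ : ℝ) (s : Equiv.Perm (Fin L)) (a : Fin L → ZMod n)
    (i : Fin L) : (momentum ℏ (s i) * act s a : Op n N L) =
      root (a i) • (act s a * momentum ℏ i : Op n N L) := by
  refine op_ext fun ψ κ v t ht => ?_
  have ht' : (fun i => t (s i)) ∈ regular L := (comp_perm_mem_regular s).2 ht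
  simp only [Module.End.mul_apply, act_apply, momentum_apply _ _ _ _ _ ht, LinearMap.smul_apply,
      Submodule.coe_smul, Pi.smul_apply, smul_eq_mul, momentum_apply _ _ _ _ _ ht']
  have h : ((act s a : Op n N L) ψ).1 κ v =
      ψ.1 (fun i => κ (s i) + a i) v ∘ (ContinuousLinearMap.pi fun i =>
        ContinuousLinearMap.proj (R := ℝ) (φ := fun _ : Fin L => ℝ) (s i)) := rfl
  rw [h, fderiv_comp _ (differentiableAt_wave ψ _ v ht') (ContinuousLinearMap.differentiableAt _),
    ContinuousLinearMap.fderiv]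
  -- The linear map `t ↦ t ∘ s` sends the basis vector at `s i` to the one at `i`.
  have h2 : (ContinuousLinearMap.pi fun i =>
        ContinuousLinearMap.proj (R := ℝ) (φ := fun _ : Fin L => ℝ) (s i))
        (Pi.single (s i) (1 : ℝ)) = Pi.single i 1 := by
    ext m
    simp [Pi.single_apply]
  rw [ContinuousLinearMap.comp_apply, h2, neg_add, root_add, root_neg (a i)]
  have := root_ne_zero (a i)
  change _ = root (a i) * (_ * fderiv ℝ _ (fun i => t (s i)) _)
  have h3 : ((ContinuousLinearMap.pi fun i =>
        ContinuousLinearMap.proj (R := ℝ) (φ := fun _ : Fin L => ℝ) (s i)) t) =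
        fun i => t (s i) := rfl
  rw [h3]
  field_simp

/-- The reflection `Q i ^ (-k) * P (i j) * Q i ^ k`. -/
def reflect (i j : Fin L) (k : ZMod n) : Op n N L :=
  act (Equiv.swap i j) (Pi.single i k + Pi.single j (-k))

theorem reflect_swap (i j : Fin L) (k : ZMod n) :
    (reflect j i (-k) : Op n N L) = reflect i j k := by
  simp only [reflect, neg_neg, Equiv.swap_comm j i, add_comm]

theorem branch_posPerm_branch {i j : Fin L} (k : ZMod n) :
    (branch i (-k) * posPerm (Equiv.swap i j) * branch i k : Op n N L) = reflect i j k := by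
  simp only [branch_eq_act, posPerm_eq_act, act_mul, reflect, one_mul, mul_one]
  congr 1
  ext m
  rw [Pi.add_apply, add_comm]
  congr 1
  simp only [Equiv.Perm.one_apply, Pi.zero_apply, add_zero, Pi.single_apply]
  congr 1
  rw [Equiv.swap_apply_eq_iff, Equiv.swap_apply_left]

/-- Conjugation moves the mirror `q_i = τ^k q_j`. The index `k` shifts exactly as it does for the
weight with the same pole, which is what makes their product equivariant. -/
theorem act_mul_reflect (s : Equiv.Perm (Fin L)) (a : Fin L → ZMod n) {i j : Fin L} (hij : i ≠ j)
    (k : ZMod n) : (act s a * reflect i j k : Op n N L) =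
      reflect (s i) (s j) (k + a j - a i) * act s a := by
  simp only [reflect, act_mul]
  congr 1
  · ext m
    simp [Equiv.swap_apply_def]
    split_ifs <;> simp_all
  · ext m
    simp only [Pi.add_apply, Pi.single_apply, s.injective.eq_iff]
    by_cases h1 : m = i
    · subst h1; simp [hij]; abel
    · by_cases h2 : m = j
      · subst h2; simp [h1]; abel
      · simp [h1, h2, Equiv.swap_apply_of_ne_of_ne]

/-- The exchange part `∑ k, 1 / (q i - τ ^ k * q j) * Q i ^ (-k) * P (i j) * Q i ^ k`. -/
def exchange [NeZero n] (i j : Fin L) : Op n N L := ∑ k : ZMod n, weight i j k * reflect i j k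

theorem exchange_self [NeZero n] (i : Fin L) : (exchange i i : Op n N L) = 0 := by
  simp [exchange, weight_self]

/-- The impurity part `∑ k, μ k / q i * Q i ^ k`. -/
def impurity [NeZero n] (μ : ZMod n → ℂ) (i : Fin L) : Op n N L :=
  ∑ k : ZMod n, μ k • (invPos i * branch i k : Op n N L)

/-- As the exchange part vanishes on the diagonal, the sum may run over all `j`; relabelling by a
permutation is then harmless. -/
theorem dunkl_eq [NeZero n] (ℏ : ℝ) (lam : ℂ) (μ : ZMod n → ℂ) (i : Fin L) :
    (dunkl ℏ lam μ i : Op n N L) =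
      momentum ℏ i + lam • (∑ j, exchange i j : Op n N L) + impurity μ i := by
  unfold dunkl impurity
  congr 3
  have h : ∑ j, (exchange i j : Op n N L) = ∑ j ∈ Finset.univ.filter (fun j => i ≠ j),
      exchange i j := by
    symm
    refine Finset.sum_subset (Finset.subset_univ _) fun j _ hj => ?_
    have : i = j := by simpa using hj
    rw [this, exchange_self]
  rw [h, Finset.sum_subtype (p := fun j => i ≠ j) _ (by simp)]
  refine Finset.sum_congr rfl fun j _ => Finset.sum_congr rfl fun k _ => ?_
  rw [branch_posPerm_branch, weight, dif_pos j.2]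

/-- The common shift of `k` in weight and reflection is absorbed by the sum over `ℤ_n`, leaving only
the phase. -/
theorem act_mul_exchange [NeZero n] (s : Equiv.Perm (Fin L)) (a : Fin L → ZMod n)
    (i j : Fin L) : (exchange (s i) (s j) * act s a : Op n N L) =
      root (a i) • (act s a * exchange i j : Op n N L) := by
  by_cases hij : i = j
  · subst hij; simp [exchange_self]
  simp only [exchange, Finset.mul_sum, Finset.sum_mul, Finset.smul_sum]
  symm
  refine Fintype.sum_equiv (Equiv.addRight (a j - a i)) _ _ fun k => ?_
  rw [← mul_assoc, act_mul_weight, smul_mul_assoc, mul_assoc, act_mul_reflect s a hij, smul_smul,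
    mul_inv_cancel₀ (root_ne_zero _), one_smul, ← mul_assoc]
  simp [add_sub_assoc]

theorem act_mul_branch (s : Equiv.Perm (Fin L)) (a : Fin L → ZMod n) (i : Fin L) (k : ZMod n) :
    (act s a * branch i k : Op n N L) = branch (s i) k * act s a := by
  simp only [branch_eq_act, act_mul, mul_one, one_mul]
  congr 1
  ext m
  simp [Pi.single_apply, add_comm]

theorem impurity_mul_act [NeZero n] (μ : ZMod n → ℂ) (s : Equiv.Perm (Fin L))
    (a : Fin L → ZMod n) (i : Fin L) : (impurity μ (s i) * act s a : Op n N L) =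
      root (a i) • (act s a * impurity μ i : Op n N L) := by
  simp only [impurity, Finset.mul_sum, Finset.sum_mul, Finset.smul_sum]
  refine Finset.sum_congr rfl fun k _ => ?_
  rw [mul_smul_comm, ← mul_assoc, act_mul_invPos, smul_mul_assoc (root (a i))⁻¹, mul_assoc _ (act s a),
    act_mul_branch,
    smul_comm (root _) (μ k), smul_smul (root _), mul_inv_cancel₀ (root_ne_zero _), one_smul,
    smul_mul_assoc, mul_assoc]

/-- Momentum, exchange and impurity parts all have degree `-1` in the positions, hence acquire the
same phase. -/
theorem dunkl_mul_act [NeZero n] (ℏ : ℝ) (lam : ℂ) (μ : ZMod n → ℂ) (s : Equiv.Perm (Fin L))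
    (a : Fin L → ZMod n) (i : Fin L) : (dunkl ℏ lam μ (s i) * act s a : Op n N L) =
      root (a i) • (act s a * dunkl ℏ lam μ i : Op n N L) := by
  simp only [dunkl_eq, add_mul, mul_add, smul_add, momentum_mul_act, impurity_mul_act]
  congr 2
  rw [smul_mul_assoc, mul_smul_comm, smul_comm (root _) lam, ← Equiv.sum_comp s]
  simp only [Finset.mul_sum, Finset.sum_mul, act_mul_exchange, Finset.smul_sum]

end

section

variable {n N L : ℕ} [NeZero n]

attribute [local instance] opRing

/-! ### Derivatives of the coefficients -/

theorem momentum_mulBy_apply (ℏ : ℝ) (i : Fin L) (f : (Fin L → ZMod n) → (Fin L → ℝ) → ℂ) (hf)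
    (ψ : WaveFn n N L) (κ v) {t} (ht : t ∈ regular L) :
    ((momentum ℏ i : Op n N L) ((mulBy f hf : Op n N L) ψ)).1 κ v t =
      f κ t * ((momentum ℏ i : Op n N L) ψ).1 κ v t +
      (-Complex.I * (ℏ : ℂ) * root (-κ i) * fderiv ℝ (f κ) t (Pi.single i 1)) * ψ.1 κ v t := by
  rw [momentum_apply _ _ _ _ _ ht, momentum_apply _ _ _ _ _ ht]
  have h : ((mulBy f hf : Op n N L) ψ).1 κ v = f κ * ψ.1 κ v := rfl
  have hd : DifferentiableAt ℝ (f κ) t :=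
    ((hf κ).contDiffAt ((isOpen_regular L).mem_nhds ht)).differentiableAt (by simp)
  rw [h, fderiv_mul hd (differentiableAt_wave ψ κ v ht)]
  simp only [add_apply, smul_apply, smul_eq_mul]
  ring

theorem hasFDerivAt_pos (i : Fin L) (κ : Fin L → ZMod n) (t : Fin L → ℝ) :
    HasFDerivAt (pos i κ) ((root (κ i)) • (Complex.ofRealCLM.comp
      (ContinuousLinearMap.proj (R := ℝ) (φ := fun _ : Fin L => ℝ) i))) t := by
  have h := (Complex.ofRealCLM.comp
      (ContinuousLinearMap.proj (R := ℝ) (φ := fun _ : Fin L => ℝ) i)).hasFDerivAt (x := t)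
  exact h.const_mul (root (κ i))

theorem fderiv_invDiff {i j : Fin L} (hij : i ≠ j) (k : ZMod n) (κ : Fin L → ZMod n) {t}
    (ht : t ∈ regular L) (l : Fin L) :
    fderiv ℝ (fun t => (pos i κ t - root k * pos j κ t)⁻¹) t (Pi.single l 1) =
      -((pos i κ t - root k * pos j κ t)⁻¹ ^ 2 * ((if l = i then root (κ i) else 0) -
        root k * (if l = j then root (κ j) else 0))) := by
  have h := ((hasFDerivAt_pos i κ t).sub ((hasFDerivAt_pos j κ t).const_mul (root k)))
  have h2 := (hasDerivAt_inv (pos_sub_ne_zero hij k κ ht)).comp_hasFDerivAt t h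
  have h3 := h2.fderiv
  have h4 : (fun t => (pos i κ t - root k * pos j κ t)⁻¹) =
    Inv.inv ∘ (fun t => pos i κ t - root k * pos j κ t) := rfl
  rw [h4]
  erw [h3]
  have e : ∀ m, (Pi.single l 1 : Fin L → ℝ) m = if l = m then 1 else 0 := fun m => by
    rw [Pi.single_apply]
    simp only [eq_comm]
  simp only [smul_apply, sub_apply, ContinuousLinearMap.comp_apply,
    ContinuousLinearMap.proj_apply, e, smul_eq_mul, Complex.ofRealCLM_apply, apply_ite Complex.ofReal,
    Complex.ofReal_one, Complex.ofReal_zero, mul_ite, mul_one, mul_zero, inv_pow, neg_mul]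

theorem fderiv_invPos (j : Fin L) (κ : Fin L → ZMod n) {t}
    (ht : t ∈ regular L) (l : Fin L) (hl : l ≠ j) :
    fderiv ℝ (fun t => (pos j κ t)⁻¹) t (Pi.single l 1) = 0 := by
  have h2 := (hasDerivAt_inv (pos_ne_zero j κ ht)).comp_hasFDerivAt t (hasFDerivAt_pos j κ t)
  have h3 := h2.fderiv
  have h4 : (fun t => (pos j κ t)⁻¹) = Inv.inv ∘ (fun t => pos j κ t) := rfl
  rw [h4]
  erw [h3]
  simp [hl.symm]

theorem weight_eq {i j : Fin L} (h : i ≠ j) (k : ZMod n) :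
    (weight i j k : Op n N L) = invDiff h k := by
  rw [weight, dif_pos h]

theorem momentum_commute_weight (ℏ : ℝ) {i j l : Fin L} (hi : l ≠ i) (hj : l ≠ j) (k : ZMod n) :
    Commute (momentum ℏ l : Op n N L) (weight i j k) := by
  by_cases hij : i = j
  · subst hij; rw [weight_self]; exact Commute.zero_right _
  rw [weight_eq hij]
  refine op_ext fun ψ κ v t ht => ?_
  rw [Module.End.mul_apply, invDiff, momentum_mulBy_apply _ _ _ _ _ _ _ ht,
    fderiv_invDiff hij k κ ht, if_neg hi, if_neg hj]
  simp [mulBy_apply]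

theorem momentum_commute_invPos (ℏ : ℝ) {j l : Fin L} (hj : l ≠ j) :
    Commute (momentum ℏ l : Op n N L) (invPos j) := by
  refine op_ext fun ψ κ v t ht => ?_
  rw [Module.End.mul_apply, invPos, momentum_mulBy_apply _ _ _ _ _ _ _ ht,
    fderiv_invPos j κ ht l hj]
  simp [mulBy_apply]

/-- The branch factor `τ^(-κ i)` of the momentum cancels that of `q_i = τ^(κ i) t_i`, so the
derivative is the ordinary one of a rational function of `q_i`. -/
theorem momentum_mul_weight_left (ℏ : ℝ) {i j : Fin L} (hij : i ≠ j) (k : ZMod n) :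
    (momentum ℏ i * weight i j k : Op n N L) = weight i j k * momentum ℏ i +
      (Complex.I * ℏ) • (weight i j k * weight i j k : Op n N L) := by
  rw [weight_eq hij]
  refine op_ext fun ψ κ v t ht => ?_
  rw [Module.End.mul_apply, invDiff, momentum_mulBy_apply _ _ _ _ _ _ _ ht,
    fderiv_invDiff hij k κ ht, if_pos rfl, if_neg hij, root_neg]
  have := root_ne_zero (κ i)
  simp only [LinearMap.add_apply, LinearMap.smul_apply, Submodule.coe_add, Submodule.coe_smul,
    Pi.add_apply, Pi.smul_apply, Module.End.mul_apply, mulBy_apply, smul_eq_mul]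
  field_simp
  ring

theorem momentum_mul_weight_right (ℏ : ℝ) {i j : Fin L} (hij : i ≠ j) (k : ZMod n) :
    (momentum ℏ j * weight i j k : Op n N L) = weight i j k * momentum ℏ j -
      (root k * (Complex.I * ℏ)) • (weight i j k * weight i j k : Op n N L) := by
  rw [weight_eq hij]
  refine op_ext fun ψ κ v t ht => ?_
  rw [Module.End.mul_apply, invDiff, momentum_mulBy_apply _ _ _ _ _ _ _ ht,
    fderiv_invDiff hij k κ ht, if_pos rfl, if_neg hij.symm, root_neg]
  have := root_ne_zero (κ j)
  simp only [LinearMap.sub_apply, LinearMap.smul_apply, Submodule.coe_sub, Submodule.coe_smul,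
    Pi.sub_apply, Pi.smul_apply, Module.End.mul_apply, mulBy_apply, smul_eq_mul]
  field_simp
  ring

theorem momentum_momentum_apply (ℏ : ℝ) (i j : Fin L) (ψ : WaveFn n N L) (κ v) {t}
    (ht : t ∈ regular L) :
    ((momentum ℏ i * momentum ℏ j : Op n N L) ψ).1 κ v t =
      (-Complex.I * (ℏ : ℂ) * root (-κ i)) * ((-Complex.I * (ℏ : ℂ) * root (-κ j)) *
        fderiv ℝ (fderiv ℝ (ψ.1 κ v)) t (Pi.single i 1) (Pi.single j 1)) := by
  rw [Module.End.mul_apply, momentum_apply _ _ _ _ _ ht]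
  congr 1
  -- The regular set is open, so the extension by zero is invisible near `t`.
  have h : ((momentum ℏ j : Op n N L) ψ).1 κ v =ᶠ[nhds t] fun t =>
      -Complex.I * (ℏ : ℂ) * root (-κ j) * fderiv ℝ (ψ.1 κ v) t (Pi.single j 1) := by
    filter_upwards [(isOpen_regular L).mem_nhds ht] with t ht
    exact momentum_apply _ _ _ _ _ ht
  have hd : DifferentiableAt ℝ (fderiv ℝ (ψ.1 κ v)) t :=
    (((ψ.2 κ v).1.fderiv_of_isOpen (isOpen_regular L) (m := ∞) (by simp)).contDiffAt
      ((isOpen_regular L).mem_nhds ht)).differentiableAt (by simp)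
  rw [h.fderiv_eq, fderiv_const_mul (hd.clm_apply (differentiableAt_const _)),
    fderiv_clm_apply hd (differentiableAt_const _)]
  simp

/-- Symmetry of the second derivative at regular points. -/
theorem momentum_commute (ℏ : ℝ) (i j : Fin L) :
    Commute (momentum ℏ i : Op n N L) (momentum ℏ j) := by
  refine op_ext fun ψ κ v t ht => ?_
  rw [momentum_momentum_apply _ _ _ _ _ _ ht, momentum_momentum_apply _ _ _ _ _ _ ht]
  have h : IsSymmSndFDerivAt ℝ (ψ.1 κ v) t :=
    ((ψ.2 κ v).1.contDiffAt ((isOpen_regular L).mem_nhds ht)).isSymmSndFDerivAt (by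
      simp only [minSmoothness_of_isRCLikeNormedField]
      exact WithTop.coe_le_coe.2 (le_top : (2 : ℕ∞) ≤ ⊤))
  rw [h.eq]
  ring

/-! ### Commutation relations of the coefficients -/

theorem weight_commute (i j c d : Fin L) (k l : ZMod n) :
    Commute (weight i j k : Op n N L) (weight c d l) := by
  by_cases h : i = j
  · subst h; rw [weight_self]; exact Commute.zero_left _
  by_cases h' : c = d
  · subst h'; rw [weight_self]; exact Commute.zero_right _
  refine op_ext fun ψ κ v t ht => ?_
  simp only [Module.End.mul_apply, weight_apply h, weight_apply h']
  ring

theorem weight_commute_invPos (i j c : Fin L) (k : ZMod n) :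
    Commute (weight i j k : Op n N L) (invPos c) := by
  by_cases h : i = j
  · subst h; rw [weight_self]; exact Commute.zero_left _
  refine op_ext fun ψ κ v t ht => ?_
  simp only [Module.End.mul_apply, weight_apply h, invPos_apply]
  ring

theorem invPos_commute (i j : Fin L) : Commute (invPos i : Op n N L) (invPos j) := by
  refine op_ext fun ψ κ v t ht => ?_
  simp only [Module.End.mul_apply, invPos_apply]
  ring

theorem weight_swap (i j : Fin L) (k : ZMod n) :
    (weight j i (-k) : Op n N L) = -(root k • (weight i j k : Op n N L)) := by
  by_cases h : i = j
  · subst h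
    rw [weight_self, weight_self, smul_zero]
    exact (neg_zero (G := Op n N L)).symm
  refine op_ext fun ψ κ v t ht => ?_
  simp only [weight_apply (Ne.symm h), LinearMap.neg_apply, LinearMap.smul_apply,
    Submodule.coe_neg, Submodule.coe_smul, Pi.neg_apply, Pi.smul_apply, smul_eq_mul,
    weight_apply h, root_neg]
  have := root_ne_zero k
  have h1 := pos_sub_ne_zero h k κ ht
  have h2 := pos_sub_ne_zero (Ne.symm h) (-k) κ ht
  rw [root_neg] at h2
  field_simp
  rw [← div_neg]
  congr 1
  ring

/-- Partial fractions, from `τ^k q_j - q_i = -(q_i - τ^k q_j)`. Used against the impurity part. -/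
theorem weight_partial_fraction {i j : Fin L} (h : i ≠ j) (k : ZMod n) :
    root k • (weight i j k * invPos i : Op n N L) - weight i j k * invPos j =
      -(invPos i * invPos j) := by
  refine op_ext fun ψ κ v t ht => ?_
  simp only [LinearMap.sub_apply, LinearMap.neg_apply, LinearMap.smul_apply, Submodule.coe_sub,
    Submodule.coe_neg, Submodule.coe_smul, Pi.neg_apply, Pi.smul_apply, Pi.sub_apply, smul_eq_mul,
    weight_apply h, Module.End.mul_apply, invPos_apply]
  have h1 := pos_sub_ne_zero h k κ ht
  have h2 := pos_ne_zero i κ ht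
  have h3 := pos_ne_zero j κ ht
  field_simp
  ring

/-- The denominators satisfy `(q_i - τ^(k+l) q_c) = (q_i - τ^k q_j) + τ^k (q_j - τ^l q_c)`; dividing
by their product gives the three-body identity. -/
theorem weight_triple {i j c : Fin L} (hij : i ≠ j) (hic : i ≠ c) (hjc : j ≠ c) (k l : ZMod n) :
    root k • (weight i j k * weight i c (k + l) : Op n N L) +
      weight i c (k + l) * weight j c l = weight j c l * weight i j k := by
  refine op_ext fun ψ κ v t ht => ?_
  simp only [LinearMap.add_apply, LinearMap.smul_apply, Submodule.coe_add,
    Submodule.coe_smul, Pi.smul_apply, Pi.add_apply, smul_eq_mul,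
    weight_apply hij, weight_apply hic, weight_apply hjc, Module.End.mul_apply]
  have h1 := pos_sub_ne_zero hij k κ ht
  have h2 := pos_sub_ne_zero hic (k + l) κ ht
  have h3 := pos_sub_ne_zero hjc l κ ht
  rw [root_add] at h2 ⊢
  field_simp
  ring

/-- Two poles for the same pair differ by `(τ^k - τ^l) q_j`. Keeping this factor in the numerator
covers the case `k = l` as well. -/
theorem weight_pair {i j : Fin L} (h : i ≠ j) (k l : ZMod n) :
    root k • (weight i j k * weight i j l : Op n N L) -
      root l • (weight i j k * weight i j l : Op n N L) =
      (invPos j * weight i j k) - (invPos j * weight i j l) := by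
  refine op_ext fun ψ κ v t ht => ?_
  simp only [LinearMap.sub_apply, LinearMap.smul_apply, Submodule.coe_sub,
    Submodule.coe_smul, Pi.smul_apply, Pi.sub_apply, smul_eq_mul,
    weight_apply h, Module.End.mul_apply, invPos_apply]
  have h1 := pos_sub_ne_zero h k κ ht
  have h2 := pos_sub_ne_zero h l κ ht
  have h3 := pos_ne_zero j κ ht
  have e : (pos i κ t - root l * pos j κ t) - (pos i κ t - root k * pos j κ t) =
    (root k - root l) * pos j κ t := by ring
  -- With the denominators as atoms, the only relation between them is `e`.
  generalize pos i κ t - root l * pos j κ t = B at *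
  generalize pos i κ t - root k * pos j κ t = A at *
  field_simp
  linear_combination (-ψ.1 κ v t) * e

end

section

variable {n N L : ℕ}

attribute [local instance] opRing

/-! ### Commutativity of the Dunkl operators -/

theorem reflect_mul_reflect (i j : Fin L) {c d : Fin L} (h : c ≠ d) (k l : ZMod n) :
    (reflect i j k * reflect c d l : Op n N L) =
      reflect (Equiv.swap i j c) (Equiv.swap i j d)
          (l + (Pi.single i k + Pi.single j (-k) : Fin L → ZMod n) d -
            (Pi.single i k + Pi.single j (-k) : Fin L → ZMod n) c) * reflect i j k :=
  act_mul_reflect _ _ h _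

theorem reflect_mul_branch (i j c : Fin L) (k m : ZMod n) :
    (reflect i j k * branch c m : Op n N L) = branch (Equiv.swap i j c) m * reflect i j k :=
  act_mul_branch _ _ _ _

theorem branch_mul_reflect (c : Fin L) {i j : Fin L} (h : i ≠ j) (m k : ZMod n) :
    (branch c m * reflect i j k : Op n N L) =
        reflect i j (k + (Pi.single c m : Fin L → ZMod n) j -
          (Pi.single c m : Fin L → ZMod n) i) * branch c m := by
  simp only [branch_eq_act]
  exact act_mul_reflect _ _ h _

theorem branch_commute (i j : Fin L) (k m : ZMod n) :
    Commute (branch i k : Op n N L) (branch j m) := by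
  have := act_mul_branch (N := N) 1 (Pi.single i k : Fin L → ZMod n) j m
  rwa [← branch_eq_act] at this

theorem reflect_mul_reflect_self {i j : Fin L} (h : i ≠ j) (k m : ZMod n) :
    (reflect i j k * reflect i j (k - m) : Op n N L) = act 1 (Pi.single i (-m) + Pi.single j m) := by
  simp only [reflect, act_mul, Equiv.swap_mul_self]
  congr 1
  ext x
  by_cases h1 : x = i
  · subst h1; simp [h]
    abel
  · by_cases h2 : x = j
    · subst h2; simp [h.symm]
    · simp [h1, h2, Equiv.swap_apply_of_ne_of_ne]

variable [NeZero n]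

/-- Normal ordering: in a product of two terms of the form function times reflection, the functions
are collected on the left. -/
theorem mul_mul_mul_of_mul_eq_smul {A : Type*} [Ring A] [Algebra ℂ A] {w r w' r' w'' : A} {c : ℂ}
    (h : r * w' = c • (w'' * r)) : w * r * (w' * r') = c • (w * w'' * (r * r')) := by
  rw [mul_assoc, ← mul_assoc r, h, smul_mul_assoc, mul_smul_comm]
  simp only [mul_assoc]

theorem exchange_shift (i j : Fin L) (k : ZMod n) :
    (exchange i j : Op n N L) = ∑ l, weight i j (k + l) * reflect i j (k + l) :=
  (Fintype.sum_equiv (Equiv.addLeft k) _ _ fun _ => rfl).symm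

theorem exchange_neg (i j : Fin L) :
    (exchange i j : Op n N L) = ∑ l, weight i j (-l) * reflect i j (-l) :=
  (Fintype.sum_equiv (Equiv.neg (ZMod n)) _ _ fun _ => rfl).symm

theorem exchange_swap (i j : Fin L) :
    (exchange j i : Op n N L) = -∑ k, root k • (weight i j k * reflect i j k : Op n N L) := by
  rw [exchange_neg, ← Finset.sum_neg_distrib]
  refine Finset.sum_congr rfl fun k _ => ?_
  rw [weight_swap, reflect_swap, neg_mul, smul_mul_assoc]

theorem reflect_mul_weight (i j c d : Fin L) (k l : ZMod n) :
    (reflect i j k * weight c d l : Op n N L) =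
      (root ((Pi.single i k + Pi.single j (-k) : Fin L → ZMod n) c))⁻¹ •
        (weight (Equiv.swap i j c) (Equiv.swap i j d)
          (l + (Pi.single i k + Pi.single j (-k) : Fin L → ZMod n) d -
            (Pi.single i k + Pi.single j (-k) : Fin L → ZMod n) c) * reflect i j k : Op n N L) :=
  act_mul_weight _ _ _ _ _

/-- The reflections with parameters `k`, `l` and `k + l` on the pairs `(i,j)`, `(j,c)`, `(i,c)`
multiply as the transpositions of three letters. After normal ordering, the three double sums carry
the same product of reflections term by term, and `weight_triple` compares the coefficients. -/
theorem exchange_triple {i j c : Fin L} (hij : i ≠ j) (hic : i ≠ c) (hjc : j ≠ c) :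
    (exchange i j * exchange j c + exchange i c * exchange j i : Op n N L) =
      exchange j c * exchange i c := by
  have e2 : ∀ k l : ZMod n, (reflect i c (k + l) * reflect j i (-k) : Op n N L) =
      reflect j c l * reflect i c (k + l) := fun k l => by
    rw [reflect_mul_reflect _ _ hij.symm]
    simp [Equiv.swap_apply_of_ne_of_ne, hij.symm, hic, hjc]
  have e3 : ∀ k l : ZMod n, (reflect j c l * reflect i c (k + l) : Op n N L) =
      reflect i j k * reflect j c l := fun k l => by
    rw [reflect_mul_reflect _ _ hic]
    simp [Equiv.swap_apply_of_ne_of_ne, hij, hjc.symm, hic]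
  have h1 : (exchange i j * exchange j c : Op n N L) = ∑ k : ZMod n, ∑ l : ZMod n,
      root k • (weight i j k * weight i c (k + l) * (reflect i j k * reflect j c l) : Op n N L) := by
    rw [exchange, exchange, Finset.sum_mul_sum]
    refine Finset.sum_congr rfl fun k _ => Finset.sum_congr rfl fun l _ => ?_
    refine mul_mul_mul_of_mul_eq_smul ?_
    rw [reflect_mul_weight]
    simp [Equiv.swap_apply_of_ne_of_ne, hij.symm, hjc.symm, hic.symm, root_neg, add_comm]
  have h2 : (exchange i c * exchange j i : Op n N L) = ∑ k : ZMod n, ∑ l : ZMod n,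
      (1 : ℂ) • (weight i c (k + l) * weight j c l * (reflect i j k * reflect j c l) :
        Op n N L) := by
    rw [exchange_neg j i, Finset.mul_sum]
    refine Finset.sum_congr rfl fun k _ => ?_
    rw [exchange_shift i c k, Finset.sum_mul]
    refine Finset.sum_congr rfl fun l _ => ?_
    rw [← e3, ← e2]
    refine mul_mul_mul_of_mul_eq_smul ?_
    rw [reflect_mul_weight]
    simp [Equiv.swap_apply_of_ne_of_ne, hij.symm, hjc, hic, root_zero]
  have h3 : (exchange j c * exchange i c : Op n N L) = ∑ k : ZMod n, ∑ l : ZMod n,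
      (1 : ℂ) • (weight j c l * weight i j k * (reflect i j k * reflect j c l) :
        Op n N L) := by
    rw [Finset.sum_comm, exchange.eq_1 j c, Finset.sum_mul]
    refine Finset.sum_congr rfl fun l _ => ?_
    rw [exchange_shift i c l, Finset.mul_sum]
    refine Finset.sum_congr rfl fun k _ => ?_
    rw [← e3, add_comm l k]
    refine mul_mul_mul_of_mul_eq_smul ?_
    rw [reflect_mul_weight]
    simp [Equiv.swap_apply_of_ne_of_ne, hij, hjc.symm, hic, root_zero]
  rw [h1, h2, h3]
  simp only [← Finset.sum_add_distrib]
  refine Finset.sum_congr rfl fun k _ => Finset.sum_congr rfl fun l _ => ?_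
  rw [one_smul, one_smul, ← weight_triple hij hic hjc, add_mul, smul_mul_assoc]

/-- A product of two reflections of the same pair only moves branches, by `-m` and `m`. For fixed
`m` the commutator has coefficient `τ^k - τ^(k+m)`, which `weight_pair` turns into a difference of
the same function at `k` and `k + m`; its sum over `ℤ_n` is zero. -/
theorem exchange_pair {i j : Fin L} (h : i ≠ j) :
    Commute (exchange i j : Op n N L) (exchange j i) := by
  have h1 : (exchange i j * exchange j i : Op n N L) = ∑ k : ZMod n, ∑ m : ZMod n,
      root k • (weight i j k * weight i j (k + m) *
        act 1 (Pi.single i (-m) + Pi.single j m) : Op n N L) := by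
    rw [exchange, Finset.sum_mul]
    refine Finset.sum_congr rfl fun k _ => ?_
    rw [exchange_shift j i (-k), Finset.mul_sum]
    refine Finset.sum_congr rfl fun m _ => ?_
    rw [← reflect_mul_reflect_self h k, ← reflect_swap i j (k - m),
      show -(k - m) = -k + m by abel]
    refine mul_mul_mul_of_mul_eq_smul ?_
    rw [reflect_mul_weight]
    simp [h, h.symm, root_neg]
    abel_nf
  have h2 : (exchange j i * exchange i j : Op n N L) = ∑ k : ZMod n, ∑ m : ZMod n,
      root (k + m) • (weight i j k * weight i j (k + m) *
        act 1 (Pi.single i (-m) + Pi.single j m) : Op n N L) := by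
    rw [exchange_neg j i, Finset.sum_mul]
    refine Finset.sum_congr rfl fun k _ => ?_
    have e : (exchange i j : Op n N L) = ∑ m, weight i j (k - m) * reflect i j (k - m) :=
      (Fintype.sum_equiv (Equiv.subLeft k) _ _ fun _ => rfl).symm
    rw [e, Finset.mul_sum]
    refine Finset.sum_congr rfl fun m _ => ?_
    have e2 : (reflect j i (-k) * weight i j (k - m) : Op n N L) =
        root (-k) • (weight j i (-(k + m)) * reflect j i (-k) : Op n N L) := by
      rw [reflect_mul_weight]
      simp [h, h.symm, root_neg]
      abel_nf
    rw [mul_mul_mul_of_mul_eq_smul e2, weight_swap, weight_swap, reflect_swap,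
      reflect_mul_reflect_self h, neg_mul_neg, smul_mul_smul_comm, smul_mul_assoc, smul_smul,
      root_neg, inv_mul_cancel_left₀ (root_ne_zero k)]
  rw [Commute, SemiconjBy, ← sub_eq_zero, h1, h2]
  simp only [← Finset.sum_sub_distrib]
  rw [Finset.sum_comm]
  refine Finset.sum_eq_zero fun m _ => ?_
  have h3 : ∀ k : ZMod n, root k • (weight i j k * weight i j (k + m) *
        act 1 (Pi.single i (-m) + Pi.single j m) : Op n N L) -
      root (k + m) • (weight i j k * weight i j (k + m) *
        act 1 (Pi.single i (-m) + Pi.single j m) : Op n N L) =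
      (invPos j * weight i j k - invPos j * weight i j (k + m)) *
        act 1 (Pi.single i (-m) + Pi.single j m) := fun k => by
    rw [← weight_pair h, sub_mul, smul_mul_assoc, smul_mul_assoc]
  simp only [h3]
  rw [← Finset.sum_mul, Finset.sum_sub_distrib, sub_eq_zero.2, zero_mul]
  exact (Fintype.sum_equiv (Equiv.addRight m) _ _ fun _ => rfl).symm

/-! ### Cross terms of momentum and exchange, and the exchange sums. -/

theorem momentum_mul_reflect (ℏ : ℝ) (i j l : Fin L) (k : ZMod n) :
    (momentum ℏ (Equiv.swap i j l) * reflect i j k : Op n N L) =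
      root ((Pi.single i k + Pi.single j (-k) : Fin L → ZMod n) l) •
        (reflect i j k * momentum ℏ l : Op n N L) :=
  momentum_mul_act _ _ _ _

/-- The reflection intertwines the momenta of `i` and `j`, so the first-order terms match. The terms
from differentiating the weight match because exchanging the roles of `i` and `j` multiplies the
weight by `-τ^k`. -/
theorem momentum_exchange (ℏ : ℝ) {i j : Fin L} (h : i ≠ j) :
    ⁅(momentum ℏ i : Op n N L), (exchange j i : Op n N L)⁆ =
      ⁅(momentum ℏ j : Op n N L), (exchange i j : Op n N L)⁆ := by
  rw [exchange_swap, lie_neg, exchange, lie_sum, lie_sum, ← Finset.sum_neg_distrib]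
  refine Finset.sum_congr rfl fun k _ => ?_
  have hi : (momentum ℏ i * reflect i j k : Op n N L) =
      (root k)⁻¹ • (reflect i j k * momentum ℏ j : Op n N L) := by
    simpa [h, h.symm, root_neg] using momentum_mul_reflect (N := N) ℏ i j j k
  have hj : (momentum ℏ j * reflect i j k : Op n N L) =
      root k • (reflect i j k * momentum ℏ i : Op n N L) := by
    simpa [h, h.symm] using momentum_mul_reflect (N := N) ℏ i j i k
  simp only [Ring.lie_def, mul_smul_comm, smul_mul_assoc]
  rw [← mul_assoc, ← mul_assoc, momentum_mul_weight_left ℏ h, momentum_mul_weight_right ℏ h,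
    add_mul, sub_mul, mul_assoc _ _ (reflect i j k), hi, mul_assoc _ (momentum ℏ j), hj]
  simp only [mul_smul_comm, smul_mul_assoc, smul_add, mul_assoc, smul_smul,
    mul_inv_cancel₀ (root_ne_zero k), one_smul]
  abel

theorem momentum_commute_exchange (ℏ : ℝ) {i j l : Fin L} (hi : l ≠ i) (hj : l ≠ j) :
    Commute (momentum ℏ l : Op n N L) (exchange i j) := by
  refine Commute.sum_right _ _ _ fun k _ =>
    (momentum_commute_weight (N := N) ℏ hi hj k).mul_right ?_
  have := momentum_mul_reflect (N := N) ℏ i j l k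
  rw [Equiv.swap_apply_of_ne_of_ne hi hj] at this
  rw [commute_iff_eq]
  simpa [hi, hj, root_zero] using this

theorem exchange_mul_reflect (i j c d : Fin L) (k : ZMod n) :
    (exchange (Equiv.swap i j c) (Equiv.swap i j d) * reflect i j k : Op n N L) =
      root ((Pi.single i k + Pi.single j (-k) : Fin L → ZMod n) c) •
        (reflect i j k * exchange c d : Op n N L) :=
  act_mul_exchange _ _ _ _

theorem exchange_commute_of_disjoint {i j c d : Fin L} (h1 : c ≠ i) (h2 : c ≠ j) (h3 : d ≠ i)
    (h4 : d ≠ j) : Commute (exchange i j : Op n N L) (exchange c d) := by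
  refine Commute.sum_left _ _ _ fun k _ => Commute.mul_left ?_ ?_
  · refine Commute.sum_right _ _ _ fun l _ =>
      (weight_commute (n := n) (N := N) (L := L) _ _ _ _ _ _).mul_right ?_
    have := reflect_mul_weight (N := N) c d i j l k
    rw [Equiv.swap_apply_of_ne_of_ne h1.symm h3.symm,
      Equiv.swap_apply_of_ne_of_ne h2.symm h4.symm] at this
    rw [commute_iff_eq]
    simpa [h1.symm, h2.symm, h3.symm, h4.symm, root_zero] using this.symm
  · have := exchange_mul_reflect (N := N) i j c d k
    rw [Equiv.swap_apply_of_ne_of_ne h1 h2,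
      Equiv.swap_apply_of_ne_of_ne h3 h4] at this
    rw [commute_iff_eq]
    simpa [h1, h2, h3, h4, root_zero] using this.symm

/-- Writing `X_il` for the exchange parts, the two orderings of `exchange_triple` subtract to a
relation of classical Yang–Baxter type, `[X_il, X_ji] + [X_il, X_jl] = -[X_ij, X_jl]`. -/
theorem lie_exchange_exchange {i j : Fin L} (h : i ≠ j) :
    ⁅(∑ l, exchange i l : Op n N L), (∑ l, exchange j l : Op n N L)⁆ = 0 := by
  rw [sum_lie]
  simp only [lie_sum]
  -- Each `l ≠ j` contributes minus one term of the expansion of the `l = j` contribution, so the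
  -- total cancels. For `l = i` both sides vanish, the right one by `exchange_pair`.
  have key : ∀ l ∈ Finset.univ.erase j, ∑ m, ⁅(exchange i l : Op n N L), (exchange j m : Op n N L)⁆ =
      -⁅(exchange i j : Op n N L), (exchange j l : Op n N L)⁆ := by
    intro l hl
    have hlj : l ≠ j := (Finset.mem_erase.1 hl).1
    by_cases hli : l = i
    · subst hli
      rw [(exchange_pair (n := n) (N := N) h).lie_eq]
      simp [exchange_self]
    · rw [Fintype.sum_eq_add i l (Ne.symm hli)]
      · have := exchange_triple (n := n) (N := N) h (Ne.symm hli) (Ne.symm hlj)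
        have h' := exchange_triple (n := n) (N := N) h.symm (Ne.symm hlj) (Ne.symm hli)
        simp only [Ring.lie_def]
        rw [← this, ← h']
        abel
      · rintro m ⟨h1, h2⟩
        by_cases hm : m = j
        · subst hm; simp [exchange_self]
        · exact (exchange_commute_of_disjoint (n := n) (N := N) h.symm (Ne.symm hlj) h1 h2).lie_eq
  rw [← Finset.add_sum_erase _ _ (Finset.mem_univ j), Finset.sum_congr rfl key,
    Finset.sum_neg_distrib, ← Finset.add_sum_erase _ _ (Finset.mem_univ j), exchange_self,
    lie_zero, zero_add, add_neg_cancel]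

theorem branch_mul_weight (c i j : Fin L) (m k : ZMod n) :
    (branch c m * weight i j k : Op n N L) =
      (root ((Pi.single c m : Fin L → ZMod n) i))⁻¹ •
        (weight i j (k + (Pi.single c m : Fin L → ZMod n) j -
          (Pi.single c m : Fin L → ZMod n) i) * branch c m : Op n N L) := by
  simp only [branch_eq_act]
  exact act_mul_weight _ _ _ _ _

theorem reflect_mul_invPos (i j c : Fin L) (k : ZMod n) :
    (reflect i j k * invPos c : Op n N L) =
      (root ((Pi.single i k + Pi.single j (-k) : Fin L → ZMod n) c))⁻¹ •
        (invPos (Equiv.swap i j c) * reflect i j k : Op n N L) :=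
  act_mul_invPos _ _ _

theorem branch_commute_invPos {i j : Fin L} (h : i ≠ j) (m : ZMod n) :
    Commute (branch i m : Op n N L) (invPos j) := by
  have := act_mul_invPos (N := N) 1 (Pi.single i m : Fin L → ZMod n) j
  rw [← branch_eq_act] at this
  rw [commute_iff_eq]
  simpa [h.symm, root_zero] using this

theorem impurity_commute (μ : ZMod n → ℂ) (i j : Fin L) :
    Commute (impurity μ i : Op n N L) (impurity μ j) := by
  by_cases h : i = j
  · rw [h]
  refine Commute.sum_left _ _ _ fun k _ => Commute.sum_right _ _ _ fun m _ => ?_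
  refine ((Commute.smul_right ?_ _).smul_left _)
  exact ((invPos_commute (n := n) (N := N) i j).mul_right
    (branch_commute_invPos (Ne.symm h) m).symm).mul_left
    ((branch_commute_invPos (n := n) (N := N) h k).mul_right (branch_commute i j k m))

theorem momentum_commute_impurity (ℏ : ℝ) (μ : ZMod n → ℂ) {i j : Fin L} (h : i ≠ j) :
    Commute (momentum ℏ i : Op n N L) (impurity μ j) := by
  refine Commute.sum_right _ _ _ fun m _ => Commute.smul_right ?_ _
  refine (momentum_commute_invPos (n := n) (N := N) ℏ h).mul_right ?_
  have := momentum_mul_act (N := N) ℏ 1 (Pi.single j m : Fin L → ZMod n) i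
  rw [← branch_eq_act] at this
  rw [commute_iff_eq]
  simpa [h, root_zero] using this

theorem exchange_commute_impurity (μ : ZMod n → ℂ) {i j l : Fin L} (hi : l ≠ i) (hj : l ≠ j) :
    Commute (exchange i j : Op n N L) (impurity μ l) := by
  refine Commute.sum_left _ _ _ fun k _ => Commute.mul_left ?_ ?_
  · refine Commute.sum_right _ _ _ fun m _ => Commute.smul_right ?_ _
    refine (weight_commute_invPos (n := n) (N := N) (L := L) _ _ _ _).mul_right ?_
    rw [commute_iff_eq]
    simpa [hi.symm, hj.symm, root_zero] using (branch_mul_weight (N := N) l i j m k).symm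
  · have := impurity_mul_act (N := N) μ (Equiv.swap i j) (Pi.single i k + Pi.single j (-k)) l
    rw [Equiv.swap_apply_of_ne_of_ne hi hj] at this
    rw [commute_iff_eq]
    simpa [hi, hj, root_zero, reflect] using this.symm

/-- For each `m`, partial fractions replace the weight over `q_i` by the weight over `q_j` plus a
multiple of `1 / (q_i q_j)`. The weights cancel, and the remainders on the two sides differ only by
the shift of `k` by `m`. -/
theorem exchange_impurity (μ : ZMod n → ℂ) {i j : Fin L} (h : i ≠ j) :
    ⁅(exchange i j : Op n N L), (impurity μ j : Op n N L)⁆ =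
      ⁅(exchange j i : Op n N L), (impurity μ i : Op n N L)⁆ := by
  simp only [impurity, lie_sum, lie_smul]
  refine Finset.sum_congr rfl fun m _ => congrArg _ ?_
  -- This brings all four products to the common form of `Q_i^m` times a reflection.
  have hb : ∀ k, (branch j m * reflect i j k : Op n N L) = branch i m * reflect i j (k + m) := by
    intro k
    rw [branch_mul_reflect j h, reflect_mul_branch]
    simp [h]
  have h1 : (exchange i j * (invPos j * branch j m) : Op n N L) =
      ∑ k, root k • (weight i j k * invPos i * (branch i m * reflect i j k) : Op n N L) := by
    rw [exchange, Finset.sum_mul]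
    refine Finset.sum_congr rfl fun k _ => ?_
    have := reflect_mul_branch (N := N) i j j k m
    rw [Equiv.swap_apply_right] at this
    rw [← this]
    refine mul_mul_mul_of_mul_eq_smul ?_
    rw [reflect_mul_invPos]
    simp [h.symm, root_neg]
  have h2 : (invPos j * branch j m * exchange i j : Op n N L) =
      ∑ k, (weight i j k * invPos j * (branch i m * reflect i j k) : Op n N L) := by
    rw [exchange, Finset.mul_sum]
    refine Fintype.sum_equiv (Equiv.addRight m) _ _ fun k => ?_
    rw [Equiv.coe_addRight, ← hb, (weight_commute_invPos i j j _).eq]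
    have := branch_mul_weight (N := N) j i j m k
    simp only [Pi.single_eq_of_ne h, Pi.single_eq_same, root_zero, inv_one, one_smul,
      sub_zero] at this
    rw [mul_assoc, ← mul_assoc (branch j m), this]
    simp only [mul_assoc]
  have h3 : (invPos i * branch i m * exchange j i : Op n N L) =
      -∑ k, root k • (weight i j k * invPos i * (branch i m * reflect i j (k + m)) : Op n N L) := by
    rw [exchange_swap, mul_neg, Finset.mul_sum]
    refine congrArg _ (Fintype.sum_equiv (Equiv.subRight m) _ _ fun k => ?_)
    rw [Equiv.subRight_apply, sub_add_cancel, (weight_commute_invPos i j i _).eq]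
    have := branch_mul_weight (N := N) i i j m k
    simp only [Pi.single_eq_of_ne h.symm, Pi.single_eq_same, add_zero] at this
    rw [mul_smul_comm, mul_assoc, ← mul_assoc (branch i m), this, root_sub, smul_mul_assoc,
      mul_smul_comm, smul_smul, div_eq_mul_inv]
    simp only [mul_assoc]
  have h4 : (exchange j i * (invPos i * branch i m) : Op n N L) =
      -∑ k, (weight i j k * invPos j * (branch i m * reflect i j (k + m)) : Op n N L) := by
    rw [exchange_swap, neg_mul, Finset.sum_mul]
    refine congrArg _ (Finset.sum_congr rfl fun k _ => ?_)
    have := reflect_mul_branch (N := N) i j i k m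
    rw [Equiv.swap_apply_left] at this
    rw [← hb, ← this, smul_mul_assoc, mul_mul_mul_of_mul_eq_smul (reflect_mul_invPos (N := N) i j i k)]
    simp [h, smul_smul, root_ne_zero]
  have h5 : ∀ k, root k • (weight i j k * invPos i * (branch i m * reflect i j k) : Op n N L) =
      weight i j k * invPos j * (branch i m * reflect i j k) -
        invPos i * invPos j * (branch i m * reflect i j k) := fun k => by
    rw [← smul_mul_assoc, sub_eq_add_neg, ← neg_mul, ← weight_partial_fraction h k, ← add_mul]
    congr 1
    abel
  have h6 : ∀ k, root k • (weight i j k * invPos i * (branch i m * reflect i j (k + m)) :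
      Op n N L) = weight i j k * invPos j * (branch i m * reflect i j (k + m)) -
        invPos i * invPos j * (branch i m * reflect i j (k + m)) := fun k => by
    rw [← smul_mul_assoc, sub_eq_add_neg, ← neg_mul, ← weight_partial_fraction h k, ← add_mul]
    congr 1
    abel
  -- The coefficient no longer depends on `k`, so the shift is a relabelling of the sum.
  have h7 : ∑ k, (invPos i * invPos j * (branch i m * reflect i j (k + m)) : Op n N L) =
      ∑ k, (invPos i * invPos j * (branch i m * reflect i j k) : Op n N L) :=
    Fintype.sum_equiv (Equiv.addRight m) _ _ fun _ => rfl
  simp only [Ring.lie_def]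
  rw [h1, h2, h3, h4]
  simp only [h5, h6, Finset.sum_sub_distrib, h7]
  abel

/-- The commutator is sorted by powers of `c`. The linear terms come in pairs, which cancel because
the mixed brackets are symmetric in primed and unprimed operators. -/
theorem commute_add_smul_add {A : Type*} [Ring A] [Algebra ℂ A] {p p' x x' m m' : A} (c : ℂ)
    (hp : Commute p p') (hx : Commute x x') (hm : Commute m m') (hpm : Commute p m')
    (hmp : Commute p' m) (hpx : ⁅p, x'⁆ = ⁅p', x⁆) (hxm : ⁅x, m'⁆ = ⁅x', m⁆) :
    Commute (p + c • x + m) (p' + c • x' + m') := by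
  rw [Ring.lie_def, Ring.lie_def, sub_eq_iff_eq_add] at hpx hxm
  rw [commute_iff_eq]
  simp only [add_mul, mul_add, smul_mul_assoc, mul_smul_comm, hp.eq, hx.eq, hm.eq, hpm.eq,
    ← hmp.eq, hpx, hxm, smul_add, smul_sub]
  abel

theorem dunkl_commute (ℏ : ℝ) (lam : ℂ) (μ : ZMod n → ℂ) (i j : Fin L) :
    Commute (dunkl ℏ lam μ i : Op n N L) (dunkl ℏ lam μ j) := by
  by_cases h : i = j
  · rw [h]
  -- Of the exchange terms attached to `j`, only the one involving `i` fails to commute with the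
  -- momentum of `i`; the same locality holds for the impurity below.
  have h1 : ∀ {i j : Fin L}, i ≠ j → ⁅(momentum ℏ i : Op n N L), (∑ l, exchange j l : Op n N L)⁆ =
      ⁅(momentum ℏ i : Op n N L), (exchange j i : Op n N L)⁆ := fun {i j} h => by
    rw [lie_sum]
    exact Fintype.sum_eq_single i fun l hl =>
      (momentum_commute_exchange (n := n) (N := N) ℏ h hl.symm).lie_eq
  have h2 : ∀ {i j : Fin L}, i ≠ j → ⁅(∑ l, exchange i l : Op n N L), (impurity μ j : Op n N L)⁆ =
      ⁅(exchange i j : Op n N L), (impurity μ j : Op n N L)⁆ := fun {i j} h => by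
    rw [sum_lie]
    exact Fintype.sum_eq_single j fun l hl =>
      (exchange_commute_impurity (N := N) μ h.symm hl.symm).lie_eq
  rw [dunkl_eq, dunkl_eq]
  refine commute_add_smul_add (A := Op n N L) lam (momentum_commute ℏ i j)
    (commute_iff_lie_eq.2 (lie_exchange_exchange h)) (impurity_commute μ i j)
    (momentum_commute_impurity ℏ μ h) (momentum_commute_impurity ℏ μ (Ne.symm h)) ?_ ?_
  · rw [h1 h, h1 (Ne.symm h), momentum_exchange ℏ h]
  · rw [h2 h, h2 (Ne.symm h), exchange_impurity μ h]

end

section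

variable {n N L : ℕ}

attribute [local instance] opRing

/-! ### Operators on spins -/

theorem spin_apply (i : Fin L) (M : Matrix (Fin N) (Fin N) ℂ) (ψ : WaveFn n N L) (κ v t) :
    ((spin i M : Op n N L) ψ).1 κ v t = ∑ w, M (v i) w * ψ.1 κ (Function.update v i w) t := rfl

theorem spinPerm_apply (s : Equiv.Perm (Fin L)) (ψ : WaveFn n N L) (κ v t) :
    ((spinPerm s : Op n N L) ψ).1 κ v t = ψ.1 κ (fun i => v (s i)) t := rfl

theorem spin_mul (i : Fin L) (M M' : Matrix (Fin N) (Fin N) ℂ) :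
    (spin i (M * M') : Op n N L) = spin i M * spin i M' := by
  refine op_ext fun ψ κ v t _ => ?_
  simp only [Module.End.mul_apply, spin_apply, Function.update_self, Function.update_idem,
    Matrix.mul_apply, Finset.sum_mul, Finset.mul_sum, mul_assoc]
  rw [Finset.sum_comm]

theorem spin_one (i : Fin L) : (spin i 1 : Op n N L) = 1 := by
  refine op_ext fun ψ κ v t _ => ?_
  simp [spin_apply, Matrix.one_apply]

theorem spin_add (i : Fin L) (M M' : Matrix (Fin N) (Fin N) ℂ) :
    (spin i (M + M') : Op n N L) = spin i M + spin i M' := by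
  refine op_ext fun ψ κ v t _ => ?_
  simp [spin_apply, add_mul, Finset.sum_add_distrib]

theorem spin_smul (i : Fin L) (c : ℂ) (M : Matrix (Fin N) (Fin N) ℂ) :
    (spin i (c • M) : Op n N L) = c • (spin i M : Op n N L) := by
  refine op_ext fun ψ κ v t _ => ?_
  simp [spin_apply, Finset.mul_sum, mul_assoc]

theorem spin_commute {i j : Fin L} (h : i ≠ j) (M M' : Matrix (Fin N) (Fin N) ℂ) :
    Commute (spin i M : Op n N L) (spin j M') := by
  refine op_ext fun ψ κ v t _ => ?_
  simp only [Module.End.mul_apply, spin_apply, Function.update_of_ne h,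
    Function.update_of_ne h.symm, Finset.mul_sum]
  rw [Finset.sum_comm]
  refine Finset.sum_congr rfl fun w _ => Finset.sum_congr rfl fun w' _ => ?_
  rw [Function.update_comm h, mul_left_comm]

theorem spinPerm_mul_spin (s : Equiv.Perm (Fin L)) (i : Fin L) (M : Matrix (Fin N) (Fin N) ℂ) :
    (spinPerm s * spin i M : Op n N L) = spin (s i) M * spinPerm s := by
  refine op_ext fun ψ κ v t _ => ?_
  simp only [Module.End.mul_apply, spin_apply, spinPerm_apply]
  refine Finset.sum_congr rfl fun w _ => ?_
  refine congrArg (fun v' => M (v (s i)) w * ψ.1 κ v' t) (funext fun m => ?_)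
  simp [Function.update_apply]

theorem act_commute_spin (s : Equiv.Perm (Fin L)) (a : Fin L → ZMod n) (i : Fin L)
    (M : Matrix (Fin N) (Fin N) ℂ) : Commute (act s a : Op n N L) (spin i M) := rfl

theorem act_commute_spinPerm (s s' : Equiv.Perm (Fin L)) (a : Fin L → ZMod n) :
    Commute (act s a : Op n N L) (spinPerm s') := rfl

theorem mulBy_commute_spin (f : (Fin L → ZMod n) → (Fin L → ℝ) → ℂ) (hf) (i : Fin L)
    (M : Matrix (Fin N) (Fin N) ℂ) : Commute (mulBy f hf : Op n N L) (spin i M) := by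
  refine op_ext fun ψ κ v t _ => ?_
  simp only [Module.End.mul_apply, spin_apply, mulBy_apply, Finset.mul_sum]
  exact Finset.sum_congr rfl fun w _ => mul_left_comm _ _ _

theorem mulBy_commute_spinPerm (f : (Fin L → ZMod n) → (Fin L → ℝ) → ℂ) (hf)
    (s : Equiv.Perm (Fin L)) : Commute (mulBy f hf : Op n N L) (spinPerm s) := rfl

theorem momentum_commute_spin [NeZero n] (ℏ : ℝ) (j i : Fin L) (M : Matrix (Fin N) (Fin N) ℂ) :
    Commute (momentum ℏ j : Op n N L) (spin i M) := by
  refine op_ext fun ψ κ v t ht => ?_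
  simp only [Module.End.mul_apply, spin_apply, momentum_apply _ _ _ _ _ ht]
  have h : ((spin i M : Op n N L) ψ).1 κ v =
      fun t => ∑ w, M (v i) w * ψ.1 κ (Function.update v i w) t := rfl
  rw [h, fderiv_fun_sum fun w _ => (differentiableAt_wave ψ _ _ ht).const_mul _]
  simp only [sum_apply, Finset.mul_sum]
  refine Finset.sum_congr rfl fun w _ => ?_
  rw [fderiv_const_mul (differentiableAt_wave ψ _ _ ht), smul_apply, smul_eq_mul,
    mul_left_comm]

theorem momentum_commute_spinPerm [NeZero n] (ℏ : ℝ) (j : Fin L) (s : Equiv.Perm (Fin L)) :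
    Commute (momentum ℏ j : Op n N L) (spinPerm s) := rfl

/-- Criterion for operators acting on spins only: the Dunkl operator is built from these three kinds
of operators. -/
theorem commute_dunkl [NeZero n] (ℏ : ℝ) (lam : ℂ) (μ : ZMod n → ℂ) (i : Fin L) {X : Op n N L}
    (h1 : Commute (momentum ℏ i : Op n N L) X) (h2 : ∀ f hf, Commute (mulBy f hf : Op n N L) X)
    (h3 : ∀ s a, Commute (act s a : Op n N L) X) :
    Commute (dunkl ℏ lam μ i : Op n N L) X := by
  rw [dunkl_eq]
  refine (h1.add_left (Commute.smul_left (Commute.sum_left _ _ _ fun j _ =>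
    Commute.sum_left _ _ _ fun k _ => Commute.mul_left ?_ (h3 _ _)) _)).add_left
    (Commute.sum_left _ _ _ fun k _ => Commute.smul_left (Commute.mul_left (h2 _ _) ?_) _)
  · by_cases h : i = j
    · subst h; rw [weight_self]; exact Commute.zero_left _
    · rw [weight_eq h]; exact h2 _ _
  · rw [branch_eq_act]; exact h3 _ _

theorem dunkl_commute_spin [NeZero n] (ℏ : ℝ) (lam : ℂ) (μ : ZMod n → ℂ) (j i : Fin L)
    (M : Matrix (Fin N) (Fin N) ℂ) : Commute (dunkl ℏ lam μ j : Op n N L) (spin i M) :=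
  commute_dunkl ℏ lam μ j (momentum_commute_spin ℏ j i M)
    (fun f hf => mulBy_commute_spin f hf i M) fun s a => act_commute_spin s a i M

theorem dunkl_commute_spinPerm [NeZero n] (ℏ : ℝ) (lam : ℂ) (μ : ZMod n → ℂ) (j : Fin L)
    (s : Equiv.Perm (Fin L)) : Commute (dunkl ℏ lam μ j : Op n N L) (spinPerm s) :=
  commute_dunkl ℏ lam μ j (momentum_commute_spinPerm ℏ j s)
    (fun f hf => mulBy_commute_spinPerm f hf s) fun s' a => act_commute_spinPerm s' s a

/-! ### Permutations of particles -/

/-- The permutation of positions and spins. -/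
def particlePerm (s : Equiv.Perm (Fin L)) : Op n N L := posPerm s * spinPerm s

theorem particlePerm_mul (s s' : Equiv.Perm (Fin L)) :
    (particlePerm (s * s') : Op n N L) = particlePerm s * particlePerm s' := rfl

theorem particlePerm_one : (particlePerm 1 : Op n N L) = 1 := rfl

theorem particlePerm_mul_spin (s : Equiv.Perm (Fin L)) (i : Fin L)
    (M : Matrix (Fin N) (Fin N) ℂ) :
    (particlePerm s * spin i M : Op n N L) = spin (s i) M * particlePerm s := by
  rw [particlePerm, mul_assoc, spinPerm_mul_spin, ← mul_assoc, posPerm_eq_act,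
    (act_commute_spin s 0 (s i) M).eq, mul_assoc]

theorem particlePerm_mul_branch (s : Equiv.Perm (Fin L)) (i : Fin L) (k : ZMod n) :
    (particlePerm s * branch i k : Op n N L) = branch (s i) k * particlePerm s := by
  have h := (act_commute_spinPerm (N := N) 1 s (Pi.single i k : Fin L → ZMod n)).eq
  rw [← branch_eq_act] at h
  rw [particlePerm, mul_assoc, ← h, ← mul_assoc, posPerm_eq_act, act_mul_branch, mul_assoc]

theorem particlePerm_mul_dunkl [NeZero n] (ℏ : ℝ) (lam : ℂ) (μ : ZMod n → ℂ)
    (s : Equiv.Perm (Fin L)) (i : Fin L) :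
    (particlePerm s * dunkl ℏ lam μ i : Op n N L) = dunkl ℏ lam μ (s i) * particlePerm s := by
  have h := dunkl_mul_act (N := N) ℏ lam μ s 0 i
  rw [Pi.zero_apply, root_zero, one_smul] at h
  rw [particlePerm, mul_assoc, ← (dunkl_commute_spinPerm ℏ lam μ i s).eq, ← mul_assoc,
    posPerm_eq_act, ← h, mul_assoc]

/-- The exponent is the representative 0 or 1 of the parity, so multiplicativity needs `ε² = 1`. -/
theorem pow_parity_mul {ε : ℂ} (hε : ε * ε = 1) (s s' : Equiv.Perm (Fin L)) :
    ε ^ parity (s * s') = ε ^ parity s * ε ^ parity s' := by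
  rcases Int.units_eq_one_or (Equiv.Perm.sign s) with h | h <;>
  rcases Int.units_eq_one_or (Equiv.Perm.sign s') with h' | h' <;>
  simp [parity, h, h', hε]

theorem pow_parity_mul_self {ε : ℂ} (hε : ε * ε = 1) (s : Equiv.Perm (Fin L)) :
    ε ^ parity s * ε ^ parity s = 1 := by
  rw [← mul_pow, hε, one_pow]

theorem statProj_eq (ε : ℂ) : (statProj ε : Op n N L) = (1 / (Nat.factorial L : ℂ)) •
    ∑ s : Equiv.Perm (Fin L), ε ^ parity s • (particlePerm s : Op n N L) := rfl

theorem particlePerm_mul_statProj {ε : ℂ} (hε : ε * ε = 1) (s : Equiv.Perm (Fin L)) :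
    (particlePerm s * statProj ε : Op n N L) = ε ^ parity s • (statProj ε : Op n N L) := by
  rw [statProj_eq, mul_smul_comm, smul_comm (ε ^ parity s), Finset.mul_sum,
    Finset.smul_sum (r := ε ^ parity s)]
  refine congrArg _ (Fintype.sum_equiv (Equiv.mulLeft s) _ _ fun s' => ?_)
  rw [Equiv.coe_mulLeft, pow_parity_mul hε, smul_smul, ← mul_assoc, pow_parity_mul_self hε,
    one_mul, mul_smul_comm, particlePerm_mul]

theorem statProj_apply_of_forall {ε : ℂ} (hε : ε * ε = 1) {ψ : WaveFn n N L}
    (h : ∀ s, (particlePerm s : Op n N L) ψ = ε ^ parity s • ψ) :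
    (statProj ε : Op n N L) ψ = ψ := by
  rw [statProj_eq]
  simp only [LinearMap.sum_apply, LinearMap.smul_apply, h, smul_smul, pow_parity_mul_self hε, one_smul,
    Finset.sum_const, Finset.card_univ, Fintype.card_perm, Fintype.card_fin]
  rw [← Nat.cast_smul_eq_nsmul ℂ, smul_smul, one_div,
    inv_mul_cancel₀ (Nat.cast_ne_zero.2 (Nat.factorial_ne_zero L)), one_smul]

theorem commute_statProj (ε : ℂ) {X : Op n N L}
    (h : ∀ s, Commute X (particlePerm s)) : Commute X (statProj ε) := by
  rw [statProj_eq]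
  exact (Commute.sum_right _ _ _ fun s _ => (h s).smul_right _).smul_right _

/-! ### Quasi-parity -/

theorem gpow_natCast [NeZero n] {G : GL (Fin N) ℂ} (hG : G ^ n = 1) (m : ℕ) :
    gpow G (m : ZMod n) = ((G ^ m : GL (Fin N) ℂ) : Matrix (Fin N) (Fin N) ℂ) := by
  rw [gpow, ZMod.val_natCast, ← pow_eq_pow_mod m hG]

theorem gpow_zero [NeZero n] (G : GL (Fin N) ℂ) : gpow G (0 : ZMod n) = 1 := by
  simp [gpow]

theorem gpow_add [NeZero n] {G : GL (Fin N) ℂ} (hG : G ^ n = 1) (k l : ZMod n) :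
    gpow G (k + l) = gpow G k * gpow G l := by
  rw [← ZMod.natCast_zmod_val k, ← ZMod.natCast_zmod_val l, ← Nat.cast_add, gpow_natCast hG,
    gpow_natCast hG, gpow_natCast hG, pow_add, Units.val_mul]

theorem gpow_neg_mul [NeZero n] {G : GL (Fin N) ℂ} (hG : G ^ n = 1) (k : ZMod n) :
    gpow G (-k) * gpow G k = 1 := by
  rw [← gpow_add hG, neg_add_cancel, gpow_zero]

theorem gpow_mul_neg [NeZero n] {G : GL (Fin N) ℂ} (hG : G ^ n = 1) (k : ZMod n) :
    gpow G k * gpow G (-k) = 1 := by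
  rw [← gpow_add hG, add_neg_cancel, gpow_zero]

theorem gpow_one [NeZero n] {G : GL (Fin N) ℂ} (hG : G ^ n = 1) :
    gpow G (1 : ZMod n) = (G : Matrix (Fin N) (Fin N) ℂ) := by
  simpa using gpow_natCast hG 1

/-- The quasi-parity operator `Q i ^ k * G i ^ (-k)`. -/
def quasiParity (G : GL (Fin N) ℂ) (i : Fin L) (k : ZMod n) : Op n N L :=
  branch i k * spin i (gpow G (-k))

theorem branch_commute_spin (i j : Fin L) (k : ZMod n) (M : Matrix (Fin N) (Fin N) ℂ) :
    Commute (branch i k : Op n N L) (spin j M) := rfl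

theorem quasiParity_add [NeZero n] {G : GL (Fin N) ℂ} (hG : G ^ n = 1) (i : Fin L)
    (k l : ZMod n) : (quasiParity G i (k + l) : Op n N L) =
      quasiParity G i k * quasiParity G i l := by
  rw [quasiParity, neg_add, gpow_add hG, branch_add, spin_mul]
  exact (branch_commute_spin i i l (gpow G (-k))).mul_mul_mul_comm _ _

theorem quasiParity_commute {G : GL (Fin N) ℂ} {i j : Fin L} (h : i ≠ j)
    (k l : ZMod n) : Commute (quasiParity G i k : Op n N L) (quasiParity G j l) :=
  ((branch_commute (N := N) i j k l).mul_right (branch_commute_spin i j k _)).mul_left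
    ((branch_commute_spin (n := n) (N := N) j i l _).symm.mul_right (spin_commute h _ _))

theorem particlePerm_mul_quasiParity (G : GL (Fin N) ℂ) (s : Equiv.Perm (Fin L)) (i : Fin L)
    (k : ZMod n) : (particlePerm s * quasiParity G i k : Op n N L) =
      quasiParity G (s i) k * particlePerm s := by
  rw [quasiParity, ← mul_assoc, particlePerm_mul_branch, mul_assoc, particlePerm_mul_spin,
    ← mul_assoc, quasiParity]

variable [NeZero n]

/-- The quasi-parity projector of one particle. -/
def parityFactor (G : GL (Fin N) ℂ) (i : Fin L) : Op n N L :=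
  (1 / (n : ℂ)) • ∑ k : ZMod n, (quasiParity G i k : Op n N L)

theorem parityProj_eq (G : GL (Fin N) ℂ) :
    (parityProj G : Op n N L) = (List.ofFn fun i => (parityFactor G i : Op n N L)).prod := rfl

theorem quasiParity_mul_parityFactor {G : GL (Fin N) ℂ} (hG : G ^ n = 1) (i : Fin L)
    (k : ZMod n) : (quasiParity G i k * parityFactor G i : Op n N L) = parityFactor G i := by
  rw [parityFactor, mul_smul_comm, Finset.mul_sum]
  congr 1
  refine Fintype.sum_equiv (Equiv.addLeft k) _ _ fun l => ?_
  rw [Equiv.coe_addLeft, quasiParity_add hG]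

theorem commute_parityFactor {G : GL (Fin N) ℂ} {i : Fin L} {X : Op n N L}
    (h : ∀ k, Commute X (quasiParity G i k)) : Commute X (parityFactor G i) :=
  (Commute.sum_right _ _ _ fun k _ => h k).smul_right _

theorem commute_parityProj {G : GL (Fin N) ℂ} {X : Op n N L}
    (h : ∀ i k, Commute X (quasiParity G i k)) : Commute X (parityProj G) := by
  rw [parityProj_eq]
  refine Commute.list_prod_right _ _ fun Y hY => ?_
  obtain ⟨i, rfl⟩ := (List.mem_ofFn' _ _).1 hY
  exact commute_parityFactor (h i)

theorem parityFactor_commute (G : GL (Fin N) ℂ) (i j : Fin L) :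
    Commute (parityFactor G i : Op n N L) (parityFactor G j) := by
  by_cases h : i = j
  · rw [h]
  · exact commute_parityFactor fun k => (commute_parityFactor fun l =>
      quasiParity_commute (Ne.symm h) k l).symm

theorem particlePerm_mul_parityFactor (G : GL (Fin N) ℂ) (s : Equiv.Perm (Fin L)) (i : Fin L) :
    (particlePerm s * parityFactor G i : Op n N L) = parityFactor G (s i) * particlePerm s := by
  simp only [parityFactor, mul_smul_comm, smul_mul_assoc, Finset.mul_sum, Finset.sum_mul,
    particlePerm_mul_quasiParity]

theorem mul_list_prod_of_forall {M ι : Type*} [Monoid M] {x : M} {f g : ι → M}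
    (h : ∀ i, x * f i = g i * x) (l : List ι) : x * (l.map f).prod = (l.map g).prod * x := by
  induction l with
  | nil => simp
  | cons a l ih =>
    simp only [List.map_cons, List.prod_cons]
    rw [← mul_assoc, h, mul_assoc, ih, mul_assoc]

/-- Conjugation permutes the one-particle factors; since they commute, the reordered product is the
same. -/
theorem particlePerm_commute_parityProj (G : GL (Fin N) ℂ) (s : Equiv.Perm (Fin L)) :
    Commute (particlePerm s : Op n N L) (parityProj G) := by
  have h := mul_list_prod_of_forall (M := Op n N L) (x := particlePerm s)
    (f := fun i => parityFactor G i) (g := fun i => parityFactor G (s i))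
    (particlePerm_mul_parityFactor G s) (List.finRange L)
  rw [← List.ofFn_eq_map, ← List.ofFn_eq_map] at h
  have h2 : (List.ofFn fun i => (parityFactor G (s i) : Op n N L)).prod =
      (List.ofFn fun i => (parityFactor G i : Op n N L)).prod := by
    refine (Equiv.Perm.ofFn_comp_perm s fun i => (parityFactor G i : Op n N L)).prod_eq' ?_
    refine List.pairwise_of_forall_mem_list fun a ha b hb => ?_
    obtain ⟨i, rfl⟩ := (List.mem_ofFn' _ _).1 ha
    obtain ⟨j, rfl⟩ := (List.mem_ofFn' _ _).1 hb
    exact parityFactor_commute G _ _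
  rw [h2] at h
  exact h

/-- `x` moves to the right past the earlier factors until it reaches `y`, which absorbs it. -/
theorem mul_list_prod_of_mem {M : Type*} [Monoid M] {x : M} {l : List M}
    (hc : ∀ y ∈ l, Commute x y) {y : M} (hy : y ∈ l) (h : x * y = y) : x * l.prod = l.prod := by
  induction l with
  | nil => simp at hy
  | cons a l ih =>
    rw [List.prod_cons]
    rcases List.mem_cons.1 hy with rfl | hy
    · rw [← mul_assoc, h]
    · rw [← mul_assoc, (hc a (by simp)).eq, mul_assoc, ih (fun y hy => hc y (by simp [hy])) hy]

theorem quasiParity_mul_parityProj {G : GL (Fin N) ℂ} (hG : G ^ n = 1) (i : Fin L)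
    (k : ZMod n) : (quasiParity G i k * parityProj G : Op n N L) = parityProj G := by
  rw [parityProj_eq]
  refine mul_list_prod_of_mem (fun y hy => ?_) ((List.mem_ofFn' _ _).2 ⟨i, rfl⟩)
    (quasiParity_mul_parityFactor hG i k)
  obtain ⟨j, rfl⟩ := (List.mem_ofFn' _ _).1 hy
  by_cases h : i = j
  · subst h
    refine commute_parityFactor fun l => ?_
    rw [commute_iff_eq, ← quasiParity_add hG, add_comm, quasiParity_add hG]
  · exact commute_parityFactor fun l => quasiParity_commute h k l

theorem list_prod_apply {R M : Type*} [Semiring R] [AddCommMonoid M] [Module R M] {x : M}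
    {l : List (Module.End R M)} (h : ∀ y ∈ l, y x = x) : l.prod x = x := by
  induction l with
  | nil => simp
  | cons a l ih =>
    rw [List.prod_cons, Module.End.mul_apply, ih fun y hy => h y (by simp [hy]),
      h a (by simp)]

/-! ### The projector onto the physical states -/

/-- The product `Λ_P Λ_Q`. -/
def physProj (G : GL (Fin N) ℂ) (ε : ℂ) : Op n N L := statProj ε * parityProj G

theorem commute_physProj {G : GL (Fin N) ℂ} (ε : ℂ) {X : Op n N L}
    (h1 : ∀ s, Commute X (particlePerm s)) (h2 : ∀ i k, Commute X (quasiParity G i k)) :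
    Commute X (physProj G ε) :=
  (commute_statProj ε h1).mul_right (commute_parityProj h2)

theorem statProj_commute_parityProj (G : GL (Fin N) ℂ) (ε : ℂ) :
    Commute (statProj ε : Op n N L) (parityProj G) :=
  (commute_statProj ε fun s => (particlePerm_commute_parityProj G s).symm).symm

theorem parity_swap {i j : Fin L} (h : i ≠ j) : parity (Equiv.swap i j) = 1 := by
  simp [parity, Equiv.Perm.sign_swap h]

theorem isProj_physProj {G : GL (Fin N) ℂ} (hG : G ^ n = 1) {ε : ℂ} (hε : ε * ε = 1) :
    LinearMap.IsProj (physical n L ε G) (physProj G ε : Op n N L) := by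
  refine ⟨fun ψ => ⟨fun i j hij => ?_, fun i => ?_⟩, fun ψ hψ => ?_⟩
  · have h : (spinPerm (Equiv.swap i j) * posPerm (Equiv.swap i j) : Op n N L) =
        particlePerm (Equiv.swap i j) := rfl
    rw [h, ← Module.End.mul_apply, physProj, ← mul_assoc, particlePerm_mul_statProj hε,
      parity_swap hij, pow_one, smul_mul_assoc, LinearMap.smul_apply]
  · have h : (spin i (G : Matrix (Fin N) (Fin N) ℂ) * quasiParity G i 1 : Op n N L) =
        branch i 1 := by
      rw [quasiParity, ← mul_assoc, ← (branch_commute_spin i i 1 _).eq, mul_assoc, ← spin_mul,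
        ← gpow_one hG, gpow_mul_neg hG, spin_one, mul_one]
    rw [physProj, (statProj_commute_parityProj G ε).eq, Module.End.mul_apply,
      ← quasiParity_mul_parityProj hG i 1, Module.End.mul_apply, ← Module.End.mul_apply, h,
      ← Module.End.mul_apply (quasiParity G i 1), quasiParity_mul_parityProj hG]
  · rw [physProj, Module.End.mul_apply]
    have h1 : (parityProj G : Op n N L) ψ = ψ := by
      rw [parityProj_eq]
      refine list_prod_apply fun y hy => ?_
      obtain ⟨i, rfl⟩ := (List.mem_ofFn' _ _).1 hy
      have h : (quasiParity G i 1 : Op n N L) ψ = ψ := by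
        rw [quasiParity, (branch_commute_spin i i 1 _).eq, Module.End.mul_apply, ← hψ.2 i,
          ← Module.End.mul_apply, ← spin_mul, ← gpow_one hG, gpow_neg_mul hG, spin_one]
        rfl
      -- The condition defining physical states concerns only the generator of `ℤ_n`; induction
      -- extends it to all powers.
      have h' : ∀ m : ℕ, (quasiParity G i (m : ZMod n) : Op n N L) ψ = ψ := by
        intro m
        induction m with
        | zero => simp [quasiParity, branch_zero, gpow_zero, spin_one]
        | succ m ih => rw [Nat.cast_succ, quasiParity_add hG, Module.End.mul_apply, h, ih]
      have h'' : ∀ k : ZMod n, (quasiParity G i k : Op n N L) ψ = ψ := fun k => by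
        rw [← ZMod.natCast_zmod_val k, h']
      unfold parityFactor
      simp only [LinearMap.smul_apply, LinearMap.sum_apply, h'', Finset.sum_const, Finset.card_univ, ZMod.card]
      rw [← Nat.cast_smul_eq_nsmul ℂ, smul_smul, one_div,
        inv_mul_cancel₀ (Nat.cast_ne_zero.2 (NeZero.ne n)), one_smul]
    rw [h1]
    refine statProj_apply_of_forall hε fun s => ?_
    -- Likewise the exchange condition is given for transpositions, which generate the symmetric
    -- group.
    induction s using Equiv.Perm.swap_induction_on with
    | one => simp [parity, particlePerm_one]
    | swap_mul s i j hij ih =>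
      rw [particlePerm_mul, Module.End.mul_apply, ih, map_smul, pow_parity_mul hε,
        parity_swap hij, pow_one, mul_comm, mul_smul]
      congr 1
      exact hψ.1 i j hij

theorem physProj_mul_self {G : GL (Fin N) ℂ} (hG : G ^ n = 1) {ε : ℂ} (hε : ε * ε = 1) :
    (physProj G ε * physProj G ε : Op n N L) = physProj G ε :=
  (isProj_physProj hG hε).isIdempotentElem

end

section

variable {n N L : ℕ}

attribute [local instance] opRing

/-! ### The representation of the loop algebra -/

/-- The action on the spin of the particle `i`, as a homomorphism of rings. -/
def spinHom (i : Fin L) : Matrix (Fin N) (Fin N) ℂ →+* Op n N L where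
  toFun := spin i
  map_one' := spin_one i
  map_mul' := spin_mul i
  map_zero' := by simpa using spin_smul (n := n) i 0 (0 : Matrix (Fin N) (Fin N) ℂ)
  map_add' := spin_add i

theorem spinHom_apply (i : Fin L) (M : Matrix (Fin N) (Fin N) ℂ) :
    (spinHom i M : Op n N L) = spin i M := rfl

variable [NeZero n]

/-- The action `Y(z) ↦ Y(d i)` on the spin of the particle `i`. -/
def particleEval (ℏ : ℝ) (lam : ℂ) (μ : ZMod n → ℂ) (i : Fin L) :
    Matrix (Fin N) (Fin N) (Polynomial ℂ) →ₐ[ℂ] Op n N L :=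
  -- A matrix of polynomials is read as a polynomial with matrix coefficients. Evaluating it
  -- multiplicatively is possible because `d_i` commutes with the spin matrices.
  { (Polynomial.eval₂RingHom' (spinHom i) (dunkl ℏ lam μ i) fun M =>
      (dunkl_commute_spin ℏ lam μ i i M).symm).comp
      (matPolyEquiv : Matrix (Fin N) (Fin N) (Polynomial ℂ) ≃ₐ[ℂ] _).toRingEquiv.toRingHom with
    commutes' := fun c => by
      have h : matPolyEquiv (algebraMap ℂ (Matrix (Fin N) (Fin N) (Polynomial ℂ)) c) =
          Polynomial.C (algebraMap ℂ (Matrix (Fin N) (Fin N) ℂ) c) := by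
        rw [AlgEquiv.commutes]
        rfl
      change Polynomial.eval₂ (spinHom i) (dunkl ℏ lam μ i) (matPolyEquiv _) = _
      rw [h, Polynomial.eval₂_C, spinHom_apply, Algebra.algebraMap_eq_smul_one, spin_smul,
        spin_one, Algebra.algebraMap_eq_smul_one] }

theorem particleEval_eq_sum (ℏ : ℝ) (lam : ℂ) (μ : ZMod n → ℂ) (i : Fin L)
    (Y : Matrix (Fin N) (Fin N) (Polynomial ℂ)) :
    (particleEval ℏ lam μ i Y : Op n N L) = ∑ p ∈ (matPolyEquiv Y).support,
      spin i ((matPolyEquiv Y).coeff p) * dunkl ℏ lam μ i ^ p :=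
  Polynomial.eval₂_eq_sum

/-- The matrix `M z ^ p`. -/
def monoMat (p : ℕ) (M : Matrix (Fin N) (Fin N) ℂ) : Matrix (Fin N) (Fin N) (Polynomial ℂ) :=
  M.map (Polynomial.monomial p)

theorem matPolyEquiv_monoMat (p : ℕ) (M : Matrix (Fin N) (Fin N) ℂ) :
    matPolyEquiv (monoMat p M) = Polynomial.monomial p M := by
  ext m i j
  rw [matPolyEquiv_coeff_apply, monoMat, Matrix.map_apply, Polynomial.coeff_monomial,
    Polynomial.coeff_monomial]
  split_ifs <;> simp

theorem particleEval_monoMat (ℏ : ℝ) (lam : ℂ) (μ : ZMod n → ℂ) (i : Fin L) (p : ℕ)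
    (M : Matrix (Fin N) (Fin N) ℂ) :
    (particleEval ℏ lam μ i (monoMat p M) : Op n N L) = spin i M * dunkl ℏ lam μ i ^ p := by
  change Polynomial.eval₂ (spinHom i) (dunkl ℏ lam μ i) (matPolyEquiv (monoMat p M)) = _
  rw [matPolyEquiv_monoMat, Polynomial.eval₂_monomial]
  rfl

/-- This is where the commutativity of the Dunkl operators enters. -/
theorem particleEval_commute (ℏ : ℝ) (lam : ℂ) (μ : ZMod n → ℂ) {i j : Fin L} (h : i ≠ j)
    (Y Z : Matrix (Fin N) (Fin N) (Polynomial ℂ)) :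
    Commute (particleEval ℏ lam μ i Y : Op n N L) (particleEval ℏ lam μ j Z) := by
  rw [particleEval_eq_sum, particleEval_eq_sum]
  refine Commute.sum_left _ _ _ fun p _ => Commute.sum_right _ _ _ fun q _ => ?_
  have h1 : ∀ (i j : Fin L) (M : Matrix (Fin N) (Fin N) ℂ),
      Commute (dunkl ℏ lam μ i : Op n N L) (spin j M) := dunkl_commute_spin ℏ lam μ
  have h2 : Commute (dunkl ℏ lam μ i : Op n N L) (dunkl ℏ lam μ j) := dunkl_commute ℏ lam μ i j
  have h3 : ∀ M M', Commute (spin i M : Op n N L) (spin j M') := spin_commute h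
  exact ((h3 _ _).mul_right ((h1 j i _).symm.pow_right q)).mul_left
    (((h1 i j _).pow_left p).mul_right (h2.pow_pow p q))

/-- The sum over all particles of the actions `Y(z) ↦ Y(d i)`. -/
def loopRep (ℏ : ℝ) (lam : ℂ) (μ : ZMod n → ℂ) :
    Matrix (Fin N) (Fin N) (Polynomial ℂ) →ₗ[ℂ] Op n N L :=
  ∑ i, (particleEval ℏ lam μ i).toLinearMap

theorem loopRep_apply (ℏ : ℝ) (lam : ℂ) (μ : ZMod n → ℂ)
    (Y : Matrix (Fin N) (Fin N) (Polynomial ℂ)) :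
    (loopRep ℏ lam μ Y : Op n N L) = ∑ i, particleEval ℏ lam μ i Y := by
  rw [loopRep, LinearMap.sum_apply]
  rfl

/-- A sum of mutually commuting representations is a representation: the brackets between different
particles vanish. No twisting is needed yet. -/
theorem loopRep_lie (ℏ : ℝ) (lam : ℂ) (μ : ZMod n → ℂ)
    (Y Z : Matrix (Fin N) (Fin N) (Polynomial ℂ)) :
    (loopRep ℏ lam μ ⁅Y, Z⁆ : Op n N L) =
      ⁅(loopRep ℏ lam μ Y : Op n N L), (loopRep ℏ lam μ Z : Op n N L)⁆ := by
  rw [loopRep_apply, loopRep_apply, loopRep_apply, sum_lie]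
  refine Finset.sum_congr rfl fun i _ => ?_
  rw [lie_sum, Fintype.sum_eq_single i fun j hj =>
    (particleEval_commute ℏ lam μ (Ne.symm hj) Y Z).lie_eq, Ring.lie_def, Ring.lie_def, map_sub,
    map_mul, map_mul]

/-- Conjugation by a permutation relabels the particles, and the sum is over all of them. -/
theorem loopRep_commute_particlePerm (ℏ : ℝ) (lam : ℂ) (μ : ZMod n → ℂ)
    (Y : Matrix (Fin N) (Fin N) (Polynomial ℂ)) (s : Equiv.Perm (Fin L)) :
    Commute (loopRep ℏ lam μ Y : Op n N L) (particlePerm s) := by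
  rw [commute_iff_eq, loopRep_apply, Finset.mul_sum, Finset.sum_mul]
  symm
  refine Fintype.sum_equiv s _ _ fun i => ?_
  rw [particleEval_eq_sum, particleEval_eq_sum, Finset.mul_sum, Finset.sum_mul]
  refine Finset.sum_congr rfl fun p _ => ?_
  have h : SemiconjBy (particlePerm s : Op n N L) (dunkl ℏ lam μ i) (dunkl ℏ lam μ (s i)) :=
    particlePerm_mul_dunkl ℏ lam μ s i
  have h' : SemiconjBy (particlePerm s : Op n N L) (spin i ((matPolyEquiv Y).coeff p))
      (spin (s i) ((matPolyEquiv Y).coeff p)) := particlePerm_mul_spin s i _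
  exact h'.mul_right (h.pow_right p)

theorem sigma_eq_rotate_iff {G : GL (Fin N) ℂ} (Y : Matrix (Fin N) (Fin N) (Polynomial ℂ)) :
    Y ∈ twistedLoop n G ↔ ∀ p, ((G⁻¹ : GL (Fin N) ℂ) : Matrix (Fin N) (Fin N) ℂ) *
      (matPolyEquiv Y).coeff p * (G : Matrix (Fin N) (Fin N) ℂ) =
      root (1 : ZMod n) ^ p • (matPolyEquiv Y).coeff p := by
  change sigma G Y = rotate n Y ↔ _
  rw [← matPolyEquiv.injective.eq_iff, Polynomial.ext_iff]
  refine forall_congr' fun p => ?_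
  have h1 : (matPolyEquiv (sigma G Y)).coeff p =
      ((G⁻¹ : GL (Fin N) ℂ) : Matrix (Fin N) (Fin N) ℂ) *
      (matPolyEquiv Y).coeff p * (G : Matrix (Fin N) (Fin N) ℂ) := by
    rw [sigma, map_mul, map_mul, matPolyEquiv_map_C, matPolyEquiv_map_C, Polynomial.coeff_mul_C,
      Polynomial.coeff_C_mul]
  have h2 : (matPolyEquiv (rotate n Y)).coeff p =
      root (1 : ZMod n) ^ p • (matPolyEquiv Y).coeff p := by
    ext i j
    rw [matPolyEquiv_coeff_apply, rotate, Matrix.map_apply, Polynomial.comp_C_mul_X_coeff,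
      Matrix.smul_apply, matPolyEquiv_coeff_apply, smul_eq_mul, mul_comm]
  rw [h1, h2]

theorem root_natCast_mul (m : ℕ) (k : ZMod n) : root ((m : ZMod n) * k) = root k ^ m := by
  induction m with
  | zero => simp [root_zero]
  | succ m ih => rw [Nat.cast_succ, add_mul, root_add, ih, one_mul, pow_succ]

theorem gpow_neg_one {G : GL (Fin N) ℂ} (hG : G ^ n = 1) :
    gpow G (-1 : ZMod n) = ((G⁻¹ : GL (Fin N) ℂ) : Matrix (Fin N) (Fin N) ℂ) := by
  have h := gpow_mul_neg hG (1 : ZMod n)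
  rw [gpow_one hG] at h
  rw [← one_mul (gpow G (-1 : ZMod n)), ← Units.val_one, ← inv_mul_cancel G, Units.val_mul,
    mul_assoc, h, mul_one]

theorem gpow_conj_of_conj {G : GL (Fin N) ℂ} (hG : G ^ n = 1) {M : Matrix (Fin N) (Fin N) ℂ}
    {p : ℕ} (h : ((G⁻¹ : GL (Fin N) ℂ) : Matrix (Fin N) (Fin N) ℂ) * M *
      (G : Matrix (Fin N) (Fin N) ℂ) = root (1 : ZMod n) ^ p • M) (k : ZMod n) :
    gpow G (-k) * M * gpow G k = root k ^ p • M := by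
  have h' : ∀ m : ℕ, gpow G (-(m : ZMod n)) * M * gpow G (m : ZMod n) =
      root (m : ZMod n) ^ p • M := by
    intro m
    induction m with
    | zero => simp [gpow_zero, root_zero]
    | succ m ih =>
      rw [Nat.cast_succ, neg_add_rev, gpow_add hG, gpow_add hG, gpow_neg_one hG, gpow_one hG]
      calc _ = ((G⁻¹ : GL (Fin N) ℂ) : Matrix (Fin N) (Fin N) ℂ) *
            (gpow G (-(m : ZMod n)) * M * gpow G (m : ZMod n)) *
            (G : Matrix (Fin N) (Fin N) ℂ) := by simp only [mul_assoc]
        _ = _ := by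
          rw [ih, mul_smul_comm, smul_mul_assoc, h, smul_smul, root_add, mul_pow]
  rw [← ZMod.natCast_zmod_val k, h']

theorem spin_mul_quasiParity {G : GL (Fin N) ℂ} (hG : G ^ n = 1) (i : Fin L) (k : ZMod n)
    (M : Matrix (Fin N) (Fin N) ℂ) : (quasiParity G i k * spin i M : Op n N L) =
      spin i (gpow G (-k) * M * gpow G k) * quasiParity G i k := by
  rw [quasiParity, ← mul_assoc, ← (branch_commute_spin i i k _).eq, mul_assoc, mul_assoc,
    ← spin_mul, ← spin_mul, mul_assoc, mul_assoc, gpow_mul_neg hG, mul_one]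

theorem quasiParity_mul_dunkl (ℏ : ℝ) (lam : ℂ) (μ : ZMod n → ℂ) (G : GL (Fin N) ℂ)
    (i j : Fin L) (k : ZMod n) :
    root ((Pi.single i k : Fin L → ZMod n) j) • (quasiParity G i k * dunkl ℏ lam μ j : Op n N L) =
      dunkl ℏ lam μ j * quasiParity G i k := by
  have h := dunkl_mul_act (N := N) ℏ lam μ 1 (Pi.single i k : Fin L → ZMod n) j
  rw [← branch_eq_act, Equiv.Perm.one_apply] at h
  rw [quasiParity, ← mul_assoc, h, smul_mul_assoc, mul_assoc, mul_assoc,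
    (dunkl_commute_spin ℏ lam μ j i _).eq]

/-- For the moved particle, the coefficient of `z^p` gains `τ^(kp)` by the twist condition on `Y`,
and `d_i^p` gains the inverse phase. For the other particles nothing changes. -/
theorem loopRep_commute_quasiParity (ℏ : ℝ) (lam : ℂ) (μ : ZMod n → ℂ) {G : GL (Fin N) ℂ}
    (hG : G ^ n = 1) {Y : Matrix (Fin N) (Fin N) (Polynomial ℂ)} (hY : Y ∈ twistedLoop n G)
    (i : Fin L) (k : ZMod n) :
    Commute (loopRep ℏ lam μ Y : Op n N L) (quasiParity G i k) := by
  rw [loopRep_apply]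
  refine Commute.sum_left _ _ _ fun j _ => ?_
  rw [particleEval_eq_sum]
  refine Commute.sum_left _ _ _ fun p _ => ?_
  have h := quasiParity_mul_dunkl (N := N) ℏ lam μ G i j k
  by_cases hj : j = i
  · subst hj
    rw [Pi.single_eq_same] at h
    have h' : SemiconjBy (quasiParity G j k : Op n N L) (root k • (dunkl ℏ lam μ j : Op n N L))
        (dunkl ℏ lam μ j) := by
      rw [SemiconjBy, mul_smul_comm]
      exact h
    have h2 : SemiconjBy (quasiParity G j k : Op n N L) (spin j ((matPolyEquiv Y).coeff p))
        (root k ^ p • (spin j ((matPolyEquiv Y).coeff p) : Op n N L)) := by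
      rw [SemiconjBy, spin_mul_quasiParity hG,
        gpow_conj_of_conj hG ((sigma_eq_rotate_iff Y).1 hY p), spin_smul]
    have h3 := h2.mul_right (h'.pow_right p)
    rw [smul_pow, mul_smul_comm, smul_mul_assoc, SemiconjBy, mul_smul_comm, smul_mul_assoc] at h3
    -- Both sides carry `τ^(kp)`, which is cancelled.
    exact (smul_right_injective _ (pow_ne_zero p (root_ne_zero k)) h3).symm
  · rw [Pi.single_eq_of_ne hj, root_zero, one_smul] at h
    have h1 : Commute (dunkl ℏ lam μ j : Op n N L) (quasiParity G i k) := h.symm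
    have h2 : Commute (spin j ((matPolyEquiv Y).coeff p) : Op n N L) (quasiParity G i k) :=
      (branch_commute_spin (n := n) (N := N) i j k _).symm.mul_right (spin_commute hj _ _)
    exact h2.mul_left (h1.pow_left p)

theorem loopRep_commute_physProj (ℏ : ℝ) (lam : ℂ) (μ : ZMod n → ℂ) {G : GL (Fin N) ℂ}
    (hG : G ^ n = 1) (ε : ℂ) {Y : Matrix (Fin N) (Fin N) (Polynomial ℂ)}
    (hY : Y ∈ twistedLoop n G) : Commute (loopRep ℏ lam μ Y : Op n N L) (physProj G ε) :=
  commute_physProj ε (loopRep_commute_particlePerm ℏ lam μ Y)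
    (loopRep_commute_quasiParity ℏ lam μ hG hY)

theorem lie_mul_of_commute {A : Type*} [Ring A] {x y e : A} (he : e * e = e) (hx : Commute x e)
    (hy : Commute y e) : ⁅x, y⁆ * e = ⁅x * e, y * e⁆ := by
  rw [Ring.lie_def, Ring.lie_def, hy.symm.mul_mul_mul_comm, hx.symm.mul_mul_mul_comm, he, sub_mul]

/-- The representation `Y(z) ↦ (∑ i, Y(d i)) Λ_P Λ_Q` of `gl_N[z]^σ`. -/
def twistedRep (ℏ : ℝ) (lam : ℂ) (μ : ZMod n → ℂ) {G : GL (Fin N) ℂ} (hG : G ^ n = 1) {ε : ℂ}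
    (hε : ε * ε = 1) : twistedLoop n G →ₗ⁅ℂ⁆ Op n N L :=
  { (LinearMap.mulRight ℂ (physProj G ε : Op n N L)) ∘ₗ (loopRep ℏ lam μ) ∘ₗ
      (twistedLoop n G).toSubmodule.subtype with
    map_lie' := fun {x y} => by
      change (loopRep ℏ lam μ ⁅(x : Matrix (Fin N) (Fin N) (Polynomial ℂ)),
        (y : Matrix (Fin N) (Fin N) (Polynomial ℂ))⁆ : Op n N L) * physProj G ε = _
      rw [loopRep_lie]
      exact lie_mul_of_commute (physProj_mul_self hG hε)
        (loopRep_commute_physProj ℏ lam μ hG ε x.2) (loopRep_commute_physProj ℏ lam μ hG ε y.2) }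

theorem twistedRep_apply (ℏ : ℝ) (lam : ℂ) (μ : ZMod n → ℂ) {G : GL (Fin N) ℂ} (hG : G ^ n = 1)
    {ε : ℂ} (hε : ε * ε = 1) (x : twistedLoop n G) :
    (twistedRep ℏ lam μ hG hε x : Op n N L) = loopRep ℏ lam μ x.1 * physProj G ε := rfl

/-- The projector stands on the right by definition; commuting it to the left shows that the image
is physical. -/
theorem twistedRep_mem (ℏ : ℝ) (lam : ℂ) (μ : ZMod n → ℂ) {G : GL (Fin N) ℂ} (hG : G ^ n = 1)
    {ε : ℂ} (hε : ε * ε = 1) (x : twistedLoop n G) (ψ : WaveFn n N L) :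
    (twistedRep ℏ lam μ hG hε x : Op n N L) ψ ∈ physical n L ε G := by
  rw [twistedRep_apply, (loopRep_commute_physProj ℏ lam μ hG ε x.2).eq, Module.End.mul_apply]
  exact (isProj_physProj hG hε).map_mem _

/-! ### The generators -/

/-- The matrix `∑ k, τ ^ (-p k) σ ^ k (M)`. -/
def twistAverage (n : ℕ) [NeZero n] (G : GL (Fin N) ℂ) (p : ℕ) :
    Matrix (Fin N) (Fin N) ℂ →ₗ[ℂ] Matrix (Fin N) (Fin N) ℂ where
  toFun M := ∑ k : ZMod n, root (-((p : ZMod n) * k)) • (gpow G (-k) * M * gpow G k)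
  map_add' M M' := by simp only [mul_add, add_mul, smul_add, Finset.sum_add_distrib]
  map_smul' c M := by
    simp only [mul_smul_comm, smul_mul_assoc, Finset.smul_sum, RingHom.id_apply, smul_comm c]

theorem twistAverage_apply (G : GL (Fin N) ℂ) (p : ℕ) (M : Matrix (Fin N) (Fin N) ℂ) :
    twistAverage n G p M =
      ∑ k : ZMod n, root (-((p : ZMod n) * k)) • (gpow G (-k) * M * gpow G k) := rfl

/-- Averaging against a character of the cyclic group generated by σ produces eigenvectors of σ. -/
theorem gpow_conj_twistAverage {G : GL (Fin N) ℂ} (hG : G ^ n = 1) (p : ℕ)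
    (M : Matrix (Fin N) (Fin N) ℂ) (l : ZMod n) :
    gpow G (-l) * twistAverage n G p M * gpow G l = root l ^ p • twistAverage n G p M := by
  rw [twistAverage_apply, Finset.mul_sum, Finset.sum_mul, Finset.smul_sum]
  refine Fintype.sum_equiv (Equiv.addLeft l) _ _ fun k => ?_
  simp only [Equiv.coe_addLeft]
  rw [smul_smul, ← root_natCast_mul, ← root_add, mul_smul_comm, smul_mul_assoc,
    show -(l + k) = -l + -k by ring, gpow_add hG (-l) (-k), add_comm l k, gpow_add hG k l]
  congr 1
  · congr 1; ring
  · simp only [mul_assoc]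

/-- The average factors through the projection to a σ-eigenspace. This yields the quasi-periodicity
of the coefficients of `B̃`. -/
theorem twistAverage_conj {G : GL (Fin N) ℂ} (hG : G ^ n = 1) (p : ℕ)
    (M : Matrix (Fin N) (Fin N) ℂ) (l : ZMod n) :
    twistAverage n G p (gpow G (-l) * M * gpow G l) = root l ^ p • twistAverage n G p M := by
  rw [twistAverage_apply, twistAverage_apply, Finset.smul_sum]
  refine Fintype.sum_equiv (Equiv.addLeft l) _ _ fun k => ?_
  rw [Equiv.coe_addLeft, smul_smul, ← root_natCast_mul, ← root_add, neg_add_rev,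
    gpow_add hG l k, gpow_add hG (-k) (-l)]
  congr 1
  · congr 1; ring
  · simp only [mul_assoc]

theorem monoMat_mem {G : GL (Fin N) ℂ} (hG : G ^ n = 1) (p : ℕ) (M : Matrix (Fin N) (Fin N) ℂ) :
    monoMat p (twistAverage n G p M) ∈ twistedLoop n G := by
  rw [sigma_eq_rotate_iff]
  intro q
  rw [matPolyEquiv_monoMat, Polynomial.coeff_monomial]
  split_ifs with h
  · subst h
    rw [← gpow_neg_one hG, ← gpow_one hG, gpow_conj_twistAverage hG]
  · simp

theorem sigma_monoMat (G : GL (Fin N) ℂ) (p : ℕ) (M : Matrix (Fin N) (Fin N) ℂ) :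
    sigma G (monoMat p M) = monoMat p (((G⁻¹ : GL (Fin N) ℂ) : Matrix (Fin N) (Fin N) ℂ) * M *
      (G : Matrix (Fin N) (Fin N) ℂ)) := by
  apply matPolyEquiv.injective
  rw [sigma, map_mul, map_mul, matPolyEquiv_map_C, matPolyEquiv_map_C, matPolyEquiv_monoMat,
    matPolyEquiv_monoMat, Polynomial.C_mul_monomial, Polynomial.monomial_mul_C]

theorem monoMat_add (p : ℕ) (M M' : Matrix (Fin N) (Fin N) ℂ) :
    monoMat p (M + M') = monoMat p M + monoMat p M' := by
  ext1 i j
  simp [monoMat]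

theorem monoMat_smul (p : ℕ) (c : ℂ) (M : Matrix (Fin N) (Fin N) ℂ) :
    monoMat p (c • M) = c • monoMat p M := by
  ext1 i j
  simp [monoMat, Polynomial.smul_monomial]

theorem monoMat_sum {ι : Type*} (s : Finset ι) (p : ℕ) (M : ι → Matrix (Fin N) (Fin N) ℂ) :
    monoMat p (∑ i ∈ s, M i) = ∑ i ∈ s, monoMat p (M i) := by
  ext1 i j
  simp [monoMat, Matrix.sum_apply]

theorem sigma_iterate_monoMat {G : GL (Fin N) ℂ} (hG : G ^ n = 1) (p : ℕ)
    (M : Matrix (Fin N) (Fin N) ℂ) (m : ℕ) : (sigma G)^[m] (monoMat p M) =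
      monoMat p (gpow G (-(m : ZMod n)) * M * gpow G (m : ZMod n)) := by
  induction m with
  | zero => simp [gpow_zero]
  | succ m ih =>
    rw [Function.iterate_succ_apply', ih, sigma_monoMat, Nat.cast_succ, neg_add_rev,
      gpow_add hG, gpow_add hG, gpow_neg_one hG, gpow_one hG]
    simp only [mul_assoc]

theorem generator_eq {G : GL (Fin N) ℂ} (hG : G ^ n = 1) (p : ℕ) (i j : Fin N) :
    generator n G p i j = monoMat p (twistAverage n G p (Matrix.single j i 1)) := by
  have h : Matrix.single j i ((Polynomial.X : Polynomial ℂ) ^ p) =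
      monoMat p (Matrix.single j i 1) := by
    rw [monoMat, Matrix.map_single, Polynomial.monomial_one_right_eq_X_pow]
  rw [generator, twistAverage_apply, monoMat_sum]
  refine Finset.sum_congr rfl fun k _ => ?_
  rw [h, sigma_iterate_monoMat hG, ZMod.natCast_zmod_val, monoMat_smul]

/-- The coefficients `∑ ℓ, (∑ k, τ ^ (-p k) σ ^ k (M))_ℓ d ℓ ^ p Λ_P Λ_Q`. -/
def twistedCoeff (ℏ : ℝ) (lam : ℂ) (μ : ZMod n → ℂ) (G : GL (Fin N) ℂ) (ε : ℂ) (p : ℕ) :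
    Matrix (Fin N) (Fin N) ℂ →ₗ[ℂ] Op n N L where
  toFun M := loopRep ℏ lam μ (monoMat p (twistAverage n G p M)) * physProj G ε
  map_add' M M' := by rw [map_add, monoMat_add, map_add, add_mul]
  map_smul' c M := by
    rw [map_smul, monoMat_smul, map_smul, smul_mul_assoc, RingHom.id_apply]

theorem twistedCoeff_apply (ℏ : ℝ) (lam : ℂ) (μ : ZMod n → ℂ) (G : GL (Fin N) ℂ) (ε : ℂ) (p : ℕ)
    (M : Matrix (Fin N) (Fin N) ℂ) : (twistedCoeff ℏ lam μ G ε p M : Op n N L) =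
      loopRep ℏ lam μ (monoMat p (twistAverage n G p M)) * physProj G ε := rfl

theorem twistedCoeff_eq_twistedRep (ℏ : ℝ) (lam : ℂ) (μ : ZMod n → ℂ) {G : GL (Fin N) ℂ}
    (hG : G ^ n = 1) {ε : ℂ} (hε : ε * ε = 1) (p : ℕ) (M : Matrix (Fin N) (Fin N) ℂ) :
    (twistedCoeff ℏ lam μ G ε p M : Op n N L) =
      twistedRep ℏ lam μ hG hε ⟨monoMat p (twistAverage n G p M), monoMat_mem hG p M⟩ := rfl

/-! ### Brackets of the averaged generators. -/

theorem monoMat_mul (p q : ℕ) (M M' : Matrix (Fin N) (Fin N) ℂ) :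
    monoMat p M * monoMat q M' = monoMat (p + q) (M * M') := by
  apply matPolyEquiv.injective
  rw [map_mul, matPolyEquiv_monoMat, matPolyEquiv_monoMat, matPolyEquiv_monoMat,
    Polynomial.monomial_mul_monomial]

/-- The second average is a σ-eigenvector with eigenvalue `τ^q`, so it can be drawn inside the first
average, at the cost of replacing `p` by `p + q`. Expanding it there gives the sum over `ℤ_n` of the
half-loop relations. -/
theorem twistAverage_lie {G : GL (Fin N) ℂ} (hG : G ^ n = 1) (p q : ℕ)
    (M M' : Matrix (Fin N) (Fin N) ℂ) :
    ⁅twistAverage n G p M, twistAverage n G q M'⁆ = twistAverage n G (p + q)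
      (∑ k : ZMod n, root (-((q : ZMod n) * k)) • ⁅M, gpow G (-k) * M' * gpow G k⁆) := by
  have h : ⁅twistAverage n G p M, twistAverage n G q M'⁆ =
      twistAverage n G (p + q) ⁅M, twistAverage n G q M'⁆ := by
    rw [twistAverage_apply G p M, sum_lie, twistAverage_apply G (p + q)]
    refine Finset.sum_congr rfl fun k _ => ?_
    have h1 := gpow_conj_twistAverage hG q M' k
    have h2 : ⁅gpow G (-k) * M * gpow G k, gpow G (-k) * twistAverage n G q M' * gpow G k⁆ =
        gpow G (-k) * ⁅M, twistAverage n G q M'⁆ * gpow G k := by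
      have h3 : ∀ A B : Matrix (Fin N) (Fin N) ℂ, gpow G (-k) * A * gpow G k *
          (gpow G (-k) * B * gpow G k) = gpow G (-k) * (A * B) * gpow G k := fun A B => by
        have := gpow_mul_neg hG k
        calc _ = gpow G (-k) * A * (gpow G k * gpow G (-k)) * B * gpow G k := by
              simp only [mul_assoc]
          _ = _ := by rw [this, mul_one]; simp only [mul_assoc]
      rw [Ring.lie_def, Ring.lie_def, h3, h3, mul_sub, sub_mul]
    rw [← h2, h1, lie_smul, smul_lie, smul_smul, Nat.cast_add, add_mul, neg_add, root_add,
      root_neg ((q : ZMod n) * k), root_natCast_mul q,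
      inv_mul_cancel_right₀ (pow_ne_zero q (root_ne_zero k))]
  rw [h, twistAverage_apply G q, lie_sum]
  simp only [lie_smul]

theorem twistedCoeff_lie (ℏ : ℝ) (lam : ℂ) (μ : ZMod n → ℂ) {G : GL (Fin N) ℂ}
    (hG : G ^ n = 1) {ε : ℂ} (hε : ε * ε = 1) (p q : ℕ) (M M' : Matrix (Fin N) (Fin N) ℂ) :
    ⁅(twistedCoeff ℏ lam μ G ε p M : Op n N L), (twistedCoeff ℏ lam μ G ε q M' : Op n N L)⁆ =
      twistedCoeff ℏ lam μ G ε (p + q)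
      (∑ k : ZMod n, root (-((q : ZMod n) * k)) • ⁅M, gpow G (-k) * M' * gpow G k⁆) := by
  rw [twistedCoeff_eq_twistedRep ℏ lam μ hG hε, twistedCoeff_eq_twistedRep ℏ lam μ hG hε,
    ← LieHom.map_lie, twistedRep_apply, twistedCoeff_apply, ← twistAverage_lie hG]
  congr 2
  change ⁅monoMat _ _, monoMat _ _⁆ = _
  rw [Ring.lie_def, Ring.lie_def, monoMat_mul, monoMat_mul, add_comm q p, sub_eq_add_neg,
    sub_eq_add_neg, monoMat_add, ← neg_one_smul ℂ, ← neg_one_smul ℂ (_ * _), monoMat_smul]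

theorem twistedCoeff_conj (ℏ : ℝ) (lam : ℂ) (μ : ZMod n → ℂ) {G : GL (Fin N) ℂ}
    (hG : G ^ n = 1) (ε : ℂ) (p : ℕ) (M : Matrix (Fin N) (Fin N) ℂ) (l : ZMod n) :
    (twistedCoeff ℏ lam μ G ε p (gpow G (-l) * M * gpow G l) : Op n N L) =
      root l ^ p • (twistedCoeff ℏ lam μ G ε p M : Op n N L) := by
  rw [twistedCoeff_apply, twistAverage_conj hG, monoMat_smul, map_smul, smul_mul_assoc,
    twistedCoeff_apply]

end

/-! ### The half-loop relations in terms of coefficients -/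

section Series

variable {A : Type*} [Ring A]

/-- The coefficient of `u ^ (-p) * v ^ (-q)`. -/
def biCoeff (p : ℕ) (q : ℤ) : TwoSeries A →+ A where
  toFun f := (PowerSeries.coeff p f).coeff q
  map_zero' := by simp
  map_add' f g := by simp

theorem biCoeff_apply (p : ℕ) (q : ℤ) (f : TwoSeries A) :
    biCoeff p q f = (PowerSeries.coeff p f).coeff q := rfl

theorem biCoeff_ext {f g : TwoSeries A} (h : ∀ p q, biCoeff p q f = biCoeff p q g) : f = g :=
  PowerSeries.ext fun p => HahnSeries.ext (funext fun q => h p q)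

theorem coeff_ofPowerSeries_of_neg (g : PowerSeries A) {q : ℤ} (hq : q < 0) :
    (HahnSeries.ofPowerSeries ℤ A g).coeff q = 0 := by
  rw [HahnSeries.ofPowerSeries_apply]
  refine HahnSeries.embDomain_of_notMem_range ?_
  rintro ⟨m, hm⟩
  have : (m : ℤ) = q := hm
  omega

theorem biCoeff_inU_mul_inV (p : ℕ) (q : ℤ) (f g : PowerSeries A) :
    biCoeff p q (inU f * inV g) =
      PowerSeries.coeff p f * (HahnSeries.ofPowerSeries ℤ A g).coeff q := by
  rw [biCoeff_apply, inV, RingHom.comp_apply, PowerSeries.coeff_mul_C, inU,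
    PowerSeries.coeff_map, HahnSeries.C_apply, HahnSeries.coeff_single_zero_mul]

theorem biCoeff_inV_mul_inU (p : ℕ) (q : ℤ) (f g : PowerSeries A) :
    biCoeff p q (inV g * inU f) =
      (HahnSeries.ofPowerSeries ℤ A g).coeff q * PowerSeries.coeff p f := by
  rw [biCoeff_apply, inV, RingHom.comp_apply, PowerSeries.coeff_C_mul, inU,
    PowerSeries.coeff_map, HahnSeries.C_apply, HahnSeries.coeff_mul_single_zero]

variable [Algebra ℂ A]

theorem biCoeff_scalar_mul (p : ℕ) (q : ℤ) (c : ℂ) (f : TwoSeries A) :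
    biCoeff p q (scalar c * f) = c • biCoeff p q f := by
  rw [biCoeff_apply, scalar, PowerSeries.coeff_C_mul, HahnSeries.C_apply,
    HahnSeries.coeff_single_zero_mul, Algebra.smul_def, biCoeff_apply]

theorem biCoeff_mul_scalar (p : ℕ) (q : ℤ) (c : ℂ) (f : TwoSeries A) :
    biCoeff p q (f * scalar c) = c • biCoeff p q f := by
  rw [biCoeff_apply, scalar, PowerSeries.coeff_mul_C, HahnSeries.C_apply,
    HahnSeries.coeff_mul_single_zero, ← Algebra.commutes, Algebra.smul_def, biCoeff_apply]

/-- The coefficients of the kernel are complex scalars times powers of `v`, hence central. -/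
theorem kernel_commute (c : ℂ) (f : TwoSeries A) : Commute (kernel c) f := by
  refine (PowerSeries.commute_X f).symm.mul_left ?_
  refine PowerSeries.ext fun p => ?_
  rw [PowerSeries.coeff_mul, PowerSeries.coeff_mul, ← Finset.Nat.sum_antidiagonal_swap]
  refine Finset.sum_congr rfl fun x _ => HahnSeries.ext (funext fun q => ?_)
  rw [Prod.fst_swap, Prod.snd_swap, PowerSeries.coeff_mk]
  obtain ⟨a, rfl⟩ : ∃ a, q = a + -(x.2 : ℤ) := ⟨q + x.2, by ring⟩
  rw [HahnSeries.coeff_mul_single_add, HahnSeries.coeff_single_mul_add,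
    Algebra.commutes]

theorem biCoeff_zero_mul_kernel (q : ℤ) (c : ℂ) (f : TwoSeries A) :
    biCoeff 0 q (f * kernel c) = 0 := by
  rw [biCoeff_apply, kernel, ← mul_assoc, ← (PowerSeries.commute_X f).eq.symm]
  simp

/-- Only the term `c^p v^p / u^(p+1)` of the kernel contributes. The Laurent index counts powers of
`v⁻¹`, so the factor `v^p` shifts it up by `p`. -/
theorem biCoeff_inV_mul_kernel (p : ℕ) (q : ℤ) (c : ℂ) (g : PowerSeries A) :
    biCoeff (p + 1) q (inV g * kernel c) =
      c ^ p • (HahnSeries.ofPowerSeries ℤ A g).coeff (q + p) := by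
  rw [biCoeff_apply, inV, RingHom.comp_apply, PowerSeries.coeff_C_mul, kernel,
    PowerSeries.coeff_succ_X_mul, PowerSeries.coeff_mk]
  obtain ⟨a, rfl⟩ : ∃ a, q = a + -(p : ℤ) := ⟨q + p, by ring⟩
  rw [HahnSeries.coeff_mul_single_add, neg_add_cancel_right, ← Algebra.commutes,
    Algebra.smul_def]

/-- All dependence on `v` comes from the kernel, so only nonnegative powers of `v`, that is indices
`q ≤ 0`, occur. -/
theorem biCoeff_inU_mul_kernel (p : ℕ) (q : ℤ) (c : ℂ) (f : PowerSeries A) :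
    biCoeff (p + 1) q (inU f * kernel c) = ∑ x ∈ Finset.HasAntidiagonal.antidiagonal p,
      if q = -(x.2 : ℤ) then c ^ x.2 • PowerSeries.coeff x.1 f else 0 := by
  rw [biCoeff_apply, kernel, ← mul_assoc, (PowerSeries.commute_X (inU f)).eq, mul_assoc,
    PowerSeries.coeff_succ_X_mul, PowerSeries.coeff_mul, HahnSeries.coeff_sum]
  refine Finset.sum_congr rfl fun x _ => ?_
  rw [PowerSeries.coeff_mk, inU, PowerSeries.coeff_map, HahnSeries.C_apply,
    HahnSeries.coeff_single_zero_mul, HahnSeries.coeff_single]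
  split_ifs
  · rw [← Algebra.commutes, Algebra.smul_def]
  · rw [mul_zero]

theorem biCoeff_inU_mul_kernel_of_pos (p : ℕ) {q : ℤ} (hq : 0 < q) (c : ℂ) (f : PowerSeries A) :
    biCoeff (p + 1) q (inU f * kernel c) = 0 := by
  rw [biCoeff_inU_mul_kernel]
  refine Finset.sum_eq_zero fun x _ => if_neg ?_
  omega

theorem biCoeff_inU_mul_kernel_of_le (r m : ℕ) (c : ℂ) (f : PowerSeries A) :
    biCoeff (r + m + 1) (-(m : ℤ)) (inU f * kernel c) = c ^ m • PowerSeries.coeff r f := by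
  rw [biCoeff_inU_mul_kernel, Finset.sum_eq_single (r, m)]
  · simp
  · rintro ⟨a, b⟩ hab hne
    rw [if_neg]
    intro h
    have h1 : a + b = r + m := Finset.HasAntidiagonal.mem_antidiagonal.1 hab
    have h2 : m = b := by simpa using h
    exact hne (by rw [h2] at h1 ⊢; rw [Nat.add_right_cancel h1])
  · intro h
    exact absurd (Finset.HasAntidiagonal.mem_antidiagonal.2 (rfl : r + m = r + m)) h

theorem biCoeff_inU_mul_kernel_of_lt {p m : ℕ} (h : p < m) (c : ℂ) (f : PowerSeries A) :
    biCoeff (p + 1) (-(m : ℤ)) (inU f * kernel c) = 0 := by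
  rw [biCoeff_inU_mul_kernel]
  refine Finset.sum_eq_zero fun x hx => if_neg ?_
  have := Finset.HasAntidiagonal.mem_antidiagonal.1 hx
  omega

variable {n N : ℕ} [NeZero n]

/-! ### Matrix entries in two auxiliary spaces. -/

theorem permAB_apply (a b c d : Fin N) :
    permAB N (a, b) (c, d) = if a = d ∧ b = c then 1 else 0 := by
  simp only [permAB, Matrix.sum_apply, Matrix.kroneckerMap_apply, Matrix.single_apply]
  rw [Finset.sum_eq_single a, Finset.sum_eq_single b]
  · by_cases h1 : a = d <;> by_cases h2 : b = c <;> simp [h1, h2]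
  · intro x _ hx
    simp [hx]
  · simp
  · intro x _ hx
    refine Finset.sum_eq_zero fun y _ => ?_
    simp [hx]
  · simp

theorem inA_apply {R : Type*} [Ring R] (Y : Matrix (Fin N) (Fin N) R) (a b c d : Fin N) :
    inA Y (a, b) (c, d) = if b = d then Y a c else 0 := by
  simp [inA, Matrix.one_apply]

theorem inB_apply {R : Type*} [Ring R] (Y : Matrix (Fin N) (Fin N) R) (a b c d : Fin N) :
    inB Y (a, b) (c, d) = if a = c then Y b d else 0 := by
  simp [inB, Matrix.one_apply]

theorem inA_mul_apply {R : Type*} [Ring R] (Y : Matrix (Fin N) (Fin N) R) (Z : AuxMat N R)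
    (i k j l : Fin N) : (inA Y * Z) (i, k) (j, l) = ∑ x, Y i x * Z (x, k) (j, l) := by
  rw [Matrix.mul_apply, Fintype.sum_prod_type]
  simp [inA_apply]

theorem mul_inA_apply {R : Type*} [Ring R] (Y : Matrix (Fin N) (Fin N) R) (Z : AuxMat N R)
    (i k j l : Fin N) : (Z * inA Y) (i, k) (j, l) = ∑ x, Z (i, k) (x, l) * Y x j := by
  rw [Matrix.mul_apply, Fintype.sum_prod_type]
  simp [inA_apply]

theorem inB_mul_apply {R : Type*} [Ring R] (Y : Matrix (Fin N) (Fin N) R) (Z : AuxMat N R)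
    (i k j l : Fin N) : (inB Y * Z) (i, k) (j, l) = ∑ x, Y k x * Z (i, x) (j, l) := by
  rw [Matrix.mul_apply, Fintype.sum_prod_type_right]
  simp [inB_apply]

theorem mul_inB_apply {R : Type*} [Ring R] (Y : Matrix (Fin N) (Fin N) R) (Z : AuxMat N R)
    (i k j l : Fin N) : (Z * inB Y) (i, k) (j, l) = ∑ x, Z (i, k) (j, x) * Y x l := by
  rw [Matrix.mul_apply, Fintype.sum_prod_type_right]
  simp [inB_apply]

theorem inA_mul_permAB_mul_inA (M M' : Matrix (Fin N) (Fin N) ℂ) (i k j l : Fin N) :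
    (inA M * permAB N * inA M') (i, k) (j, l) = M i l * M' k j := by
  rw [mul_inA_apply]
  simp only [inA_mul_apply, permAB_apply]
  rw [Finset.sum_eq_single k, Finset.sum_eq_single l]
  · simp
  · intro x _ hx; simp [hx]
  · simp
  · intro x _ hx
    rw [Finset.sum_eq_zero, zero_mul]
    intro y _
    simp [Ne.symm hx]
  · simp

/-- The kernel and the scalars are central, so they move past the entries of `U` and `V`; the entry
of `G_a^(-m) P_ab G_a^m` factors as in `inA_mul_permAB_mul_inA`. -/
theorem biCoeff_lie_kernel (P : ℕ) (Q : ℤ) (G : GL (Fin N) ℂ) (m : ZMod n)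
    (U V : Matrix (Fin N) (Fin N) (TwoSeries A)) (i k j l : Fin N) :
    biCoeff P Q (⁅(scalar (root m) : TwoSeries A) • inA U + inB V,
      (kernel (root m) : TwoSeries A) •
        (inA (gpow G (-m)) * permAB N * inA (gpow G m)).map scalar⁆ (i, k) (j, l)) =
      root m • (∑ x, (gpow G (-m) x l * gpow G m k j) • biCoeff P Q (U i x * kernel (root m)) -
        ∑ x, (gpow G (-m) i l * gpow G m k x) • biCoeff P Q (U x j * kernel (root m))) +
      (∑ x, (gpow G (-m) i l * gpow G m x j) • biCoeff P Q (V k x * kernel (root m)) -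
        ∑ x, (gpow G (-m) i x * gpow G m k j) • biCoeff P Q (V x l * kernel (root m))) := by
  have hc : ∀ (c : ℂ) (f : TwoSeries A), Commute f (scalar c) := fun c f =>
    biCoeff_ext fun p q => by rw [biCoeff_scalar_mul, biCoeff_mul_scalar]
  have hs : ∀ (c d : ℂ) (f : TwoSeries A), biCoeff P Q (f * (kernel d * scalar c)) =
      c • biCoeff P Q (f * kernel d) := fun c d f => by rw [← mul_assoc, biCoeff_mul_scalar]
  have hs' : ∀ (c d : ℂ) (f : TwoSeries A), biCoeff P Q (kernel d * scalar c * f) =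
      c • biCoeff P Q (f * kernel d) := fun c d f => by
    rw [(hc _ _).eq, mul_assoc, biCoeff_scalar_mul, (kernel_commute _ _).eq]
  rw [Ring.lie_def, add_mul, mul_add, Matrix.sub_apply, Matrix.add_apply, Matrix.add_apply,
    Matrix.smul_mul, Matrix.smul_apply, inA_mul_apply, inB_mul_apply, mul_inB_apply]
  have h : ((kernel (root m) : TwoSeries A) •
        (inA (gpow G (-m)) * permAB N * inA (gpow G m)).map scalar *
        (scalar (root m) : TwoSeries A) • inA U : AuxMat N (TwoSeries A)) (i, k) (j, l) =
      scalar (root m) * (((kernel (root m) : TwoSeries A) •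
        (inA (gpow G (-m)) * permAB N * inA (gpow G m)).map scalar * inA U : AuxMat N (TwoSeries A))
          (i, k) (j, l)) := by
    rw [Matrix.mul_apply, Matrix.mul_apply, Finset.mul_sum]
    refine Finset.sum_congr rfl fun x _ => ?_
    rw [Matrix.smul_apply (scalar (root m)), smul_eq_mul, ← mul_assoc, (hc _ _).eq, mul_assoc]
  rw [h, mul_inA_apply]
  simp only [Matrix.smul_apply, Matrix.map_apply, inA_mul_permAB_mul_inA, smul_eq_mul, map_sub,
    map_add, map_sum, biCoeff_scalar_mul, hs, hs', smul_sub]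
  abel

/-- The twisted half-loop relations follow from the commutation relations of the coefficients
`b p i j` of `u ^ (-(p + 1))`. -/
theorem twistedHalfLoop_of_coeff {G : GL (Fin N) ℂ}
    {B : Matrix (Fin N) (Fin N) (PowerSeries A)} (b : ℕ → Matrix (Fin N) (Fin N) A)
    (hB0 : ∀ i j, PowerSeries.coeff 0 (B i j) = 0)
    (hB : ∀ p i j, PowerSeries.coeff (p + 1) (B i j) = b p i j)
    (hsym : ∀ (r : ℕ) (m : ZMod n) (i j : Fin N),
      ∑ x, gpow G m i x • b r x j = root m ^ r • ∑ x, gpow G m x j • b r i x)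
    (hcomm : ∀ (p q : ℕ) (i j k l : Fin N), b p i j * b q k l - b q k l * b p i j =
      ∑ m : ZMod n, root m ^ p •
        (∑ x, (gpow G (-m) i l * gpow G m x j) • b (p + q) k x -
          ∑ x, (gpow G (-m) i x * gpow G m k j) • b (p + q) x l)) :
    TwistedHalfLoop n G B := by
  have hneg : ∀ (q : ℕ) (f : PowerSeries A), (HahnSeries.ofPowerSeries ℤ A f).coeff (q : ℤ) =
      PowerSeries.coeff q f := fun q f => HahnSeries.ofPowerSeries_apply_coeff f q
  have hnonpos : ∀ (q : ℤ) (i j), q ≤ 0 →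
      (HahnSeries.ofPowerSeries ℤ A (B i j)).coeff q = 0 := fun q i j hq => by
    rcases hq.lt_or_eq with h | rfl
    · exact coeff_ofPowerSeries_of_neg _ h
    · have := hneg 0 (B i j)
      rw [hB0] at this
      exact_mod_cast this
  unfold TwistedHalfLoop
  ext1 ⟨i, k⟩ ⟨j, l⟩
  refine biCoeff_ext fun P Q => ?_
  rw [Matrix.sum_apply, map_sum]
  simp only [biCoeff_lie_kernel, Matrix.map_apply]
  have hL : biCoeff P Q (⁅inA (B.map inU), inB (B.map inV)⁆ (i, k) (j, l)) =
      PowerSeries.coeff P (B i j) * (HahnSeries.ofPowerSeries ℤ A (B k l)).coeff Q -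
      (HahnSeries.ofPowerSeries ℤ A (B k l)).coeff Q * PowerSeries.coeff P (B i j) := by
    rw [Ring.lie_def, Matrix.sub_apply, inA_mul_apply, mul_inA_apply, map_sub]
    simp [inB_apply, biCoeff_inU_mul_inV, biCoeff_inV_mul_inU]
  rw [hL]
  cases P with
  | zero => simp [biCoeff_zero_mul_kernel, hB0]
  | succ p =>
    rcases lt_or_ge 0 Q with hQ | hQ
    -- Negative powers of `v`: the `B_a(u)` part of the right side has none, and the `B_b(v)` part
    -- is precisely the commutator of coefficients.
    · obtain ⟨q, rfl⟩ : ∃ q : ℕ, Q = ((q + 1 : ℕ) : ℤ) :=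
        ⟨(Q - 1).toNat, by push_cast; omega⟩
      have h1 : ∀ i j, (HahnSeries.ofPowerSeries ℤ A (B i j)).coeff (((q + 1 : ℕ) : ℤ) + p) =
          b (p + q) i j := fun i j => by
        rw [← Nat.cast_add, hneg, show q + 1 + p = (p + q) + 1 by ring, hB]
      rw [hneg, hB, hB, hcomm]
      refine Finset.sum_congr rfl fun m _ => ?_
      simp only [biCoeff_inU_mul_kernel_of_pos p hQ, biCoeff_inV_mul_kernel, h1, smul_zero,
        Finset.sum_const_zero, sub_zero, zero_add, smul_sub, Finset.smul_sum,
        smul_comm (root m ^ p)]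
    -- Nonnegative powers of `v`: the left side has none, so the two parts of the right side must
    -- cancel. They do so for each `m` separately.
    · rw [hnonpos Q k l hQ, mul_zero, zero_mul, sub_zero]
      symm
      refine Finset.sum_eq_zero fun m _ => ?_
      obtain ⟨a, rfl⟩ : ∃ a : ℕ, Q = -(a : ℤ) := ⟨(-Q).toNat, by omega⟩
      simp only [biCoeff_inV_mul_kernel]
      rcases lt_or_ge p a with h | h
      · simp only [biCoeff_inU_mul_kernel_of_lt h, smul_zero,
          Finset.sum_const_zero, sub_zero, zero_add]
        have h1 : ∀ i j, (HahnSeries.ofPowerSeries ℤ A (B i j)).coeff (-(a : ℤ) + p) = 0 :=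
          fun i j => hnonpos _ i j (by omega)
        simp [h1]
      · obtain ⟨s, rfl⟩ := Nat.exists_eq_add_of_le' h
        have h1 : ∀ i j, (HahnSeries.ofPowerSeries ℤ A (B i j)).coeff
            (-(a : ℤ) + ((s + a : ℕ) : ℤ)) = PowerSeries.coeff s (B i j) := fun i j => by
          rw [← hneg]
          congr 1
          push_cast
          ring
        simp only [biCoeff_inU_mul_kernel_of_le, h1]
        cases s with
        | zero => simp [hB0]
        | succ r =>
          simp only [hB]
          -- By `hsym` the sums from `B_a(u)` become those from `B_b(v)`. The prefactor `τ^m` makes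
          -- up the exponent `r + 1 + a`, so `e1` cancels against `e4` and `e2` against `e3`.
          have e1 : ∑ x, (gpow G (-m) x l * gpow G m k j) • root m ^ a • b r i x =
              (root m ^ a * gpow G m k j * root m ^ r) • ∑ x, gpow G (-m) i x • b r x l := by
            rw [hsym r (-m) i l, smul_smul, root_neg, inv_pow,
              mul_inv_cancel_right₀ (pow_ne_zero r (root_ne_zero m)), Finset.smul_sum]
            refine Finset.sum_congr rfl fun x _ => ?_
            rw [smul_smul, smul_smul]
            congr 1
            ring
          have e2 : ∑ x, (gpow G (-m) i l * gpow G m k x) • root m ^ a • b r x j =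
              (root m ^ a * gpow G (-m) i l * root m ^ r) • ∑ x, gpow G m x j • b r k x := by
            rw [mul_smul, ← hsym r m k j, Finset.smul_sum]
            refine Finset.sum_congr rfl fun x _ => ?_
            rw [smul_smul, smul_smul]
            congr 1
            ring
          have e3 : ∑ x, (gpow G (-m) i l * gpow G m x j) • root m ^ (r + 1 + a) • b r k x =
              (root m ^ (r + 1 + a) * gpow G (-m) i l) • ∑ x, gpow G m x j • b r k x := by
            rw [Finset.smul_sum]
            refine Finset.sum_congr rfl fun x _ => ?_
            rw [smul_smul, smul_smul]
            congr 1
            ring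
          have e4 : ∑ x, (gpow G (-m) i x * gpow G m k j) • root m ^ (r + 1 + a) • b r x l =
              (root m ^ (r + 1 + a) * gpow G m k j) • ∑ x, gpow G (-m) i x • b r x l := by
            rw [Finset.smul_sum]
            refine Finset.sum_congr rfl fun x _ => ?_
            rw [smul_smul, smul_smul]
            congr 1
            ring
          rw [e1, e2, e3, e4]
          module

end Series

section

variable {n N L : ℕ}

attribute [local instance] opRing

/-! ### The coefficients of the modified monodromy matrix -/

theorem spinHom_smul (i : Fin L) (c : ℂ) (M : Matrix (Fin N) (Fin N) ℂ) :
    (spinHom i (c • M) : Op n N L) = c • (spinHom i M : Op n N L) := spin_smul i c M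

variable [NeZero n]

theorem twisted_apply (G : GL (Fin N) ℂ) (ℏ : ℝ) (lam : ℂ) (μ : ZMod n → ℂ) (i j : Fin N) :
    (twisted G ℏ lam μ i j : PowerSeries (Op n N L)) = ∑ k : ZMod n, root k •
      ∑ b, ∑ a, PowerSeries.C (algebraMap ℂ (Op n N L) (gpow G k i a)) *
        dilate (root k) (monodromy ℏ lam μ a b : PowerSeries (Op n N L)) *
        PowerSeries.C (algebraMap ℂ (Op n N L) (gpow G (-k) b j)) := by
  unfold twisted
  rw [Matrix.sum_apply]
  refine Finset.sum_congr rfl fun k _ => ?_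
  simp only [Matrix.smul_apply, Matrix.mul_apply, constMat, Matrix.map_apply, Finset.sum_mul]

theorem coeff_monodromy_zero (ℏ : ℝ) (lam : ℂ) (μ : ZMod n → ℂ) (i j : Fin N) :
    PowerSeries.coeff 0 (monodromy ℏ lam μ i j : PowerSeries (Op n N L)) = 0 := by
  rw [monodromy, Matrix.of_apply, map_sum]
  refine Finset.sum_eq_zero fun l _ => ?_
  rw [PowerSeries.coeff_C_mul, PowerSeries.coeff_zero_X_mul, mul_zero]

theorem coeff_monodromy_succ (ℏ : ℝ) (lam : ℂ) (μ : ZMod n → ℂ) (p : ℕ) (i j : Fin N) :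
    PowerSeries.coeff (p + 1) (monodromy ℏ lam μ i j : PowerSeries (Op n N L)) =
      ∑ l, spin l (Matrix.single j i 1) * dunkl ℏ lam μ l ^ p := by
  rw [monodromy, Matrix.of_apply, map_sum]
  refine Finset.sum_congr rfl fun l _ => ?_
  rw [PowerSeries.coeff_C_mul, PowerSeries.coeff_succ_X_mul, PowerSeries.coeff_mk]

theorem coeff_twisted (G : GL (Fin N) ℂ) (ℏ : ℝ) (lam : ℂ) (μ : ZMod n → ℂ) (p : ℕ)
    (i j : Fin N) : PowerSeries.coeff p (twisted G ℏ lam μ i j : PowerSeries (Op n N L)) =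
      ∑ k : ZMod n, ∑ b, ∑ a, (root k * (root k)⁻¹ ^ p * (gpow G k i a * gpow G (-k) b j)) •
        (PowerSeries.coeff p (monodromy ℏ lam μ a b) : Op n N L) := by
  rw [twisted_apply, map_sum]
  refine Finset.sum_congr rfl fun k _ => ?_
  rw [PowerSeries.coeff_smul, map_sum, Finset.smul_sum]
  refine Finset.sum_congr rfl fun b _ => ?_
  rw [map_sum, Finset.smul_sum]
  refine Finset.sum_congr rfl fun a _ => ?_
  rw [PowerSeries.coeff_mul_C, PowerSeries.coeff_C_mul]
  unfold dilate
  rw [PowerSeries.coeff_mk, ← Algebra.commutes, ← Algebra.smul_def, ← Algebra.smul_def, smul_smul, smul_smul, smul_smul]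
  congr 1
  ring

theorem conj_single (M M' : Matrix (Fin N) (Fin N) ℂ) (i j : Fin N) :
    M' * Matrix.single j i 1 * M = ∑ b, ∑ a, (M i a * M' b j) • Matrix.single b a (1 : ℂ) := by
  rw [Matrix.matrix_eq_sum_single (M' * Matrix.single j i 1 * M)]
  refine Finset.sum_congr rfl fun b _ => Finset.sum_congr rfl fun a _ => ?_
  rw [Matrix.smul_single, smul_eq_mul, mul_one]
  congr 1
  rw [Matrix.mul_apply, Finset.sum_eq_single i, Matrix.mul_single_apply_same, mul_one, mul_comm]
  · intro x _ hx
    rw [Matrix.mul_single_apply_of_ne _ _ _ _ _ (Ne.symm hx).symm, zero_mul]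
  · simp

theorem coeff_modified_zero (G : GL (Fin N) ℂ) (ε : ℂ) (ℏ : ℝ) (lam : ℂ) (μ : ZMod n → ℂ)
    (i j : Fin N) :
    PowerSeries.coeff 0 (modified G ε ℏ lam μ i j : PowerSeries (Op n N L)) = 0 := by
  rw [modified, Matrix.map_apply, PowerSeries.coeff_mul_C, coeff_twisted]
  simp only [coeff_monodromy_zero, smul_zero, Finset.sum_const_zero, zero_mul]

/-- `P_aℓ` turns conjugation by `G^k` in the auxiliary space into conjugation by `G^(-k)` on the
spin ℓ. The factor `τ^k` of `B` and `τ^(-k(p+1))` from `T(τ^k u)` combine to `τ^(-pk)`. -/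
theorem coeff_modified_succ (G : GL (Fin N) ℂ) (ε : ℂ) (ℏ : ℝ) (lam : ℂ) (μ : ZMod n → ℂ) (p : ℕ)
    (i j : Fin N) :
    PowerSeries.coeff (p + 1) (modified G ε ℏ lam μ i j : PowerSeries (Op n N L)) =
      twistedCoeff ℏ lam μ G ε p (Matrix.single j i 1) := by
  rw [modified, Matrix.map_apply, PowerSeries.coeff_mul_C, coeff_twisted, twistedCoeff_apply,
    physProj]
  congr 1
  rw [loopRep_apply]
  simp only [particleEval_monoMat, coeff_monodromy_succ, Finset.smul_sum]
  have h : ∀ l : Fin L, (spin l (twistAverage n G p (Matrix.single j i 1)) : Op n N L) =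
      ∑ k : ZMod n, ∑ b, ∑ a, (root k * (root k)⁻¹ ^ (p + 1) *
        (gpow G k i a * gpow G (-k) b j)) • (spin l (Matrix.single b a 1) : Op n N L) := by
    intro l
    rw [twistAverage_apply, ← spinHom_apply, map_sum]
    refine Finset.sum_congr rfl fun k _ => ?_
    rw [conj_single, spinHom_smul, map_sum, Finset.smul_sum]
    refine Finset.sum_congr rfl fun b _ => ?_
    rw [map_sum, Finset.smul_sum]
    refine Finset.sum_congr rfl fun a _ => ?_
    rw [spinHom_smul, smul_smul, spinHom_apply, root_neg, root_natCast_mul]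
    congr 1
    have := root_ne_zero k
    rw [pow_succ, inv_pow]
    field_simp
  simp only [h, Finset.sum_mul, smul_mul_assoc]
  symm
  rw [Finset.sum_comm]
  refine Finset.sum_congr rfl fun k _ => ?_
  rw [Finset.sum_comm]
  refine Finset.sum_congr rfl fun b _ => ?_
  rw [Finset.sum_comm]

/-! ### The half-loop relations and the charges -/

theorem sum_smul_single_left (M : Matrix (Fin N) (Fin N) ℂ) (l m : Fin N) :
    M * Matrix.single l m 1 = ∑ x, M x l • Matrix.single x m (1 : ℂ) := by
  ext a b
  simp only [Matrix.sum_apply, Matrix.smul_apply, Matrix.mul_apply, Matrix.single_apply]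
  by_cases h : m = b <;> simp [h]

theorem sum_smul_single_right (M : Matrix (Fin N) (Fin N) ℂ) (l m : Fin N) :
    Matrix.single l m 1 * M = ∑ x, M m x • Matrix.single l x (1 : ℂ) := by
  ext a b
  simp only [Matrix.sum_apply, Matrix.smul_apply, Matrix.mul_apply, Matrix.single_apply]
  by_cases h : l = a <;> simp [h]

/-- Entrywise form of `G_a^m B̃^(p) = τ^(mp) B̃^(p) G_a^m`. -/
theorem gpow_mul_twistedCoeff (ℏ : ℝ) (lam : ℂ) (μ : ZMod n → ℂ) {G : GL (Fin N) ℂ}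
    (hG : G ^ n = 1) (ε : ℂ) (p : ℕ) (m : ZMod n) (i j : Fin N) :
    ∑ x, gpow G m i x • (twistedCoeff ℏ lam μ G ε p (Matrix.single j x 1) : Op n N L) =
      root m ^ p • ∑ x, gpow G m x j •
        (twistedCoeff ℏ lam μ G ε p (Matrix.single x i 1) : Op n N L) := by
  simp only [← map_smul, ← map_sum]
  rw [← sum_smul_single_left, ← sum_smul_single_right, map_smul, ← twistedCoeff_conj _ _ _ hG]
  congr 1
  rw [← mul_assoc, gpow_neg_mul hG, one_mul]

theorem lie_single_conj (M M' : Matrix (Fin N) (Fin N) ℂ) (i j k l : Fin N) :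
    ⁅Matrix.single j i (1 : ℂ), M' * Matrix.single l k 1 * M⁆ =
      ∑ x, (M' i l * M k x) • Matrix.single j x (1 : ℂ) -
      ∑ x, (M k j * M' x l) • Matrix.single x i (1 : ℂ) := by
  have h0 (a b : Fin N) (c : ℂ) : Matrix.single a b c = c • Matrix.single a b (1 : ℂ) := by
    rw [Matrix.smul_single, smul_eq_mul, mul_one]
  have h1 : Matrix.single j i (1 : ℂ) * (M' * Matrix.single l k 1 * M) =
      ∑ x, (M' i l * M k x) • Matrix.single j x (1 : ℂ) := by
    rw [← mul_assoc, ← mul_assoc, Matrix.single_mul_mul_single, one_mul, mul_one, h0,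
      smul_mul_assoc, sum_smul_single_right, Finset.smul_sum]
    simp only [smul_smul]
  have h2 : M' * Matrix.single l k 1 * M * Matrix.single j i (1 : ℂ) =
      ∑ x, (M k j * M' x l) • Matrix.single x i (1 : ℂ) := by
    rw [mul_assoc, mul_assoc, ← mul_assoc (Matrix.single l k 1), Matrix.single_mul_mul_single,
      one_mul, mul_one, h0, mul_smul_comm, sum_smul_single_left, Finset.smul_sum]
    simp only [smul_smul]
  rw [Ring.lie_def, h1, h2]

theorem twistedHalfLoop_modified {G : GL (Fin N) ℂ} (hG : G ^ n = 1) {ε : ℂ} (hε : ε * ε = 1)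
    (ℏ : ℝ) (lam : ℂ) (μ : ZMod n → ℂ) :
    TwistedHalfLoop n G
      (modified G ε ℏ lam μ : Matrix (Fin N) (Fin N) (PowerSeries (Op n N L))) := by
  refine twistedHalfLoop_of_coeff (A := Op n N L)
    (fun p i j => twistedCoeff ℏ lam μ G ε p (Matrix.single j i 1))
    (coeff_modified_zero G ε ℏ lam μ) (coeff_modified_succ G ε ℏ lam μ)
    (fun r m i j => gpow_mul_twistedCoeff ℏ lam μ hG ε r m i j) fun p q i j k l => ?_
  have h := twistedCoeff_lie (L := L) ℏ lam μ hG hε p q (Matrix.single j i 1) (Matrix.single l k 1)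
  rw [Ring.lie_def] at h
  rw [h, map_sum]
  refine Finset.sum_congr rfl fun m _ => ?_
  -- The bracket of averages has `G^(±m)` on the other side of the coefficient matrix and phase
  -- `τ^(-qm)`; moving it across in the first sum supplies `τ^((p+q)m)`, in the second the same
  -- balance holds with `-m`.
  have h1 := gpow_mul_twistedCoeff (L := L) ℏ lam μ hG ε (p + q) m k j
  have h2 := gpow_mul_twistedCoeff (L := L) ℏ lam μ hG ε (p + q) (-m) i l
  simp only [mul_smul, ← Finset.smul_sum, smul_comm _ (gpow G m k j)]
  rw [h2]
  rw [map_smul, lie_single_conj, map_sub, map_sum, map_sum]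
  simp only [map_smul, mul_smul, ← Finset.smul_sum]
  rw [h1, smul_sub, smul_sub, root_neg, root_neg, root_natCast_mul, inv_pow]
  simp only [smul_smul, pow_add]
  have := root_ne_zero m
  congr 2
  · field_simp
  · field_simp

/-- A nontrivial character sums to zero: shifting the index multiplies the sum by a root different
from 1. -/
theorem sum_root_eq_zero {k : ℕ} (h : ¬ n ∣ k) :
    ∑ l : ZMod n, root (-((k : ZMod n) * l)) = 0 := by
  have h1 : root (-(k : ZMod n)) ≠ 1 := fun h1 => by
    rw [← root_zero (n := n)] at h1
    have h2 := ZMod.injective_stdAddChar h1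
    exact h ((ZMod.natCast_eq_zero_iff k n).1 (neg_eq_zero.1 h2))
  have h2 : root (-(k : ZMod n)) * ∑ l : ZMod n, root (-((k : ZMod n) * l)) =
      ∑ l : ZMod n, root (-((k : ZMod n) * l)) := by
    rw [Finset.mul_sum]
    refine Fintype.sum_equiv (Equiv.addLeft 1) _ _ fun l => ?_
    rw [← root_add, Equiv.coe_addLeft]
    congr 1
    ring
  have h3 : (root (-(k : ZMod n)) - 1) * ∑ l : ZMod n, root (-((k : ZMod n) * l)) = 0 := by
    rw [sub_mul, h2, one_mul, sub_self]
  exact (mul_eq_zero.1 h3).resolve_left (sub_ne_zero.2 h1)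

theorem twistAverage_one {G : GL (Fin N) ℂ} (hG : G ^ n = 1) (k : ℕ) :
    twistAverage n G k 1 = (∑ l : ZMod n, root (-((k : ZMod n) * l))) • 1 := by
  rw [twistAverage_apply, Finset.sum_smul]
  refine Finset.sum_congr rfl fun l _ => ?_
  rw [mul_one, gpow_neg_mul hG]

/-- The trace adds up the diagonal matrix units, giving the identity matrix. -/
theorem charge_eq (G : GL (Fin N) ℂ) (ε : ℂ) (ℏ : ℝ) (lam : ℂ) (μ : ZMod n → ℂ) (k : ℕ) :
    (charge G ε ℏ lam μ k : Op n N L) = twistedCoeff ℏ lam μ G ε k 1 := by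
  rw [charge, Matrix.trace, map_sum]
  simp only [Matrix.diag_apply, coeff_modified_succ]
  rw [← map_sum, Matrix.sum_single_one]

/-- The charge is the image of a multiple of `z^k · 1`, which is central in `gl_N[z]`. -/
theorem charge_commute_twistedRep (ℏ : ℝ) (lam : ℂ) (μ : ZMod n → ℂ) {G : GL (Fin N) ℂ}
    (hG : G ^ n = 1) {ε : ℂ} (hε : ε * ε = 1) (x : twistedLoop n G) (k : ℕ) :
    Commute (twistedRep ℏ lam μ hG hε x : Op n N L) (charge G ε ℏ lam μ k) := by
  rw [charge_eq, twistedCoeff_eq_twistedRep ℏ lam μ hG hε, commute_iff_lie_eq, ← LieHom.map_lie]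
  have h : ⁅x, (⟨monoMat k (twistAverage n G k 1), monoMat_mem hG k 1⟩ : twistedLoop n G)⁆ =
      0 := by
    apply Subtype.ext
    change ⁅x.1, monoMat k (twistAverage n G k 1)⁆ = 0
    have h : Commute x.1 (monoMat k (1 : Matrix (Fin N) (Fin N) ℂ)) := by
      apply matPolyEquiv.injective
      rw [map_mul, map_mul, matPolyEquiv_monoMat, Polynomial.monomial_one_right_eq_X_pow]
      exact (Polynomial.commute_X_pow _ k).eq.symm
    rw [twistAverage_one hG, monoMat_smul, lie_smul, commute_iff_lie_eq.1 h, smul_zero]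
  rw [h, map_zero]

theorem charge_eq_zero (ℏ : ℝ) (lam : ℂ) (μ : ZMod n → ℂ) {G : GL (Fin N) ℂ}
    (hG : G ^ n = 1) (ε : ℂ) {k : ℕ} (h : ¬ n ∣ k) :
    (charge G ε ℏ lam μ k : Op n N L) = 0 := by
  rw [charge_eq, twistedCoeff_apply, twistAverage_one hG, sum_root_eq_zero h, zero_smul,
    ← zero_smul ℂ (1 : Matrix (Fin N) (Fin N) ℂ), monoMat_smul, zero_smul, map_zero, zero_mul]

end

end TwistedCalogero

end

theorem mainTheorem6 (n N L : ℕ) [NeZero n] (G : GL (Fin N) ℂ) (hG : G ^ n = 1)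
    (ε : ℂ) (hε : ε = 1 ∨ ε = -1) (ℏ : ℝ) (lam : ℂ) (μ : ZMod n → ℂ) :
    -- the operator `Λ_P Λ_Q` is the projector onto the physical states
    LinearMap.IsProj (physical n L ε G) (statProj ε * parityProj G : Op n N L) ∧
    -- the modified generators preserve exchange statistics and quasi-parity
    (∀ (i j : Fin N) (m : ℕ) (ψ : WaveFn n N L),
      PowerSeries.coeff m (modified G ε ℏ lam μ i j) ψ ∈ physical n L ε G) ∧
    -- they satisfy the twisted half-loop relations
    TwistedHalfLoop n G (modified G ε ℏ lam μ : Matrix (Fin N) (Fin N) (PowerSeries (Op n N L))) ∧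
    -- the trace has no constant term, its other coefficients being the charges, which commute
    PowerSeries.coeff 0
      (modified G ε ℏ lam μ : Matrix (Fin N) (Fin N) (PowerSeries (Op n N L))).trace = 0 ∧
    (∀ k l : ℕ, Commute (charge G ε ℏ lam μ k : Op n N L) (charge G ε ℏ lam μ l)) ∧
    -- and vanish unless `k` is divisible by `n`
    (∀ k : ℕ, ¬ n ∣ k → (charge G ε ℏ lam μ k : Op n N L) = 0) ∧
    -- the modified generators represent `gl_N[z]^σ` on the physical states, by operators which
    -- commute with all charges
    ∃ ρ : twistedLoop n G →ₗ⁅ℂ⁆ Op n N L,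
      (∀ (p : ℕ) (i j : Fin N), ∃ x : twistedLoop n G,
        (x : Matrix (Fin N) (Fin N) (Polynomial ℂ)) = generator n G p i j ∧
        ρ x = PowerSeries.coeff (p + 1) (modified G ε ℏ lam μ i j)) ∧
      (∀ (x : twistedLoop n G) (ψ : WaveFn n N L), ρ x ψ ∈ physical n L ε G) ∧
      (∀ (x : twistedLoop n G) (k : ℕ), Commute (ρ x) (charge G ε ℏ lam μ k)) := by
  have hε' : ε * ε = 1 := by rcases hε with rfl | rfl <;> norm_num
  refine ⟨isProj_physProj hG hε', fun i j m ψ => ?_, twistedHalfLoop_modified hG hε' ℏ lam μ, ?_,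
    fun k l => ?_, fun k h => charge_eq_zero ℏ lam μ hG ε h,
    twistedRep ℏ lam μ hG hε', fun p i j => ?_, twistedRep_mem ℏ lam μ hG hε',
    charge_commute_twistedRep ℏ lam μ hG hε'⟩
  · cases m with
    | zero =>
      rw [coeff_modified_zero, LinearMap.zero_apply]
      exact zero_mem _
    | succ p =>
      rw [coeff_modified_succ, twistedCoeff_eq_twistedRep ℏ lam μ hG hε']
      exact twistedRep_mem ℏ lam μ hG hε' _ ψ
  · rw [Matrix.trace, map_sum]
    exact Finset.sum_eq_zero fun i _ => coeff_modified_zero G ε ℏ lam μ i i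
  -- The charges are themselves in the image of `ρ`, so their commutation is a case of the symmetry.
  · have h := charge_commute_twistedRep (L := L) ℏ lam μ hG hε'
      ⟨monoMat k (twistAverage n G k 1), monoMat_mem hG k 1⟩ l
    rwa [← twistedCoeff_eq_twistedRep, ← charge_eq] at h
  · refine ⟨⟨monoMat p (twistAverage n G p (Matrix.single j i 1)), monoMat_mem hG p _⟩,
      (generator_eq hG p i j).symm, ?_⟩
    rw [coeff_modified_succ]
    rfl
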